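/- **Theorem 5.2.** Let $Q$ be the alternative hypothesis, under which the next-token prediction vector is a constant non-degenerate probability vector $\mathbf P$, and let $Y_1,Y_2,\dots$ be the $[0,1]$-valued pivotal statistics of the watermarking scheme. Assume that under $Q$ they are iid with a law $F^{\mathbf P}$ that is strictly super-uniform, i.e. $Q(Y_1\le y)<y$ for all $y\in(0,1)$, and satisfies $\mathrm{KL}(F^{\mathbf P}\,\|\,\mathrm U)<\infty$, where $\mathrm U$ is the uniform law on $[0,1]$. (The scheme and $\mathbf P$ enter only through this property of the $Y_t$; no other property of them is used.) A *calibrator* is a decreasing function $g\ge 0$ on $[0,1]$ with $\int_0^1 g=1$ (the value at $0$ is immaterial, and $g(0+)=\infty$ is allowed). It is *nonconstant* if it is not constant on $(0,1)$. *Weight-adaptive e-process.* Let $g$ be a nonconstant calibrator and $\gamma\in(0,1)$. Let $\lambda_1=0$ and, for $t\ge2$, let $$\lambda_t\in\operatorname*{arg\,max}_{\lambda\in[0,\gamma]}\ \sum_{s=1}^{t-1}\log\bigl(1-\lambda+\lambda g(1-Y_s)\bigr),$$ where $\lambda_t$ is measurable with respect to $\sigma(Y_1,\dots,Y_{t-1})$.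 Put $M^{\mathrm{WA}}_T=\prod_{t=1}^T\bigl(1-\lambda_t+\lambda_t g(1-Y_t)\bigr)$. *Online Grenander (OG) e-process with range $[a,b]$.* Let $0<a<1<b<\infty$, and let $\mathcal D_{a,b}$ be the set of decreasing functions $f:[0,1]\to[a,b]$ with $\int_0^1 f=1$. For every $t\ge1$ let $f_t$ be a maximizer over $f\in\mathcal D_{a,b}$ of one of $$\log f(1)+\sum_{s=1}^{t-1}\log f(1-Y_s)\qquad\text{or}\qquad \sum_{s=1}^{t-1}\log f(1-Y_s)+\tfrac12\log f(0)+\tfrac12\log f(1)$$ (the choice between the two may depend on $t$), determined by $Y_1,\dots,Y_{t-1}$ (each $f_t(p)$ is $\sigma(Y_1,\dots,Y_{t-1})$-measurable). Put $M^{\mathrm{OG}}_T=\prod_{t=1}^T f_t(1-Y_t)$. *Average e-process.* $M^{\mathrm{AV}}_T=\tfrac12M^{\mathrm{WA}}_T+\tfrac12M^{\mathrm{OG}}_T$. Then each of the three processes $M\in\{M^{\mathrm{WA}},M^{\mathrm{OG}},M^{\mathrm{AV}}\}$ grows exponentially under $Q$: there is a constant $c>0$ (which may differ among the three) such that $$\frac1T\log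 M_T\longrightarrow c\quad\text{in $Q$-probability as }T\to\infty .$$ Moreover, for each of them and every $\alpha\in(0,1)$, the online test at level $\alpha$ is consistent: $$Q\Bigl(\max_{1\le t\le T}M_t\ge \tfrac1\alpha\Bigr)\longrightarrow 1\quad\text{as }T\to\infty .$$ Finally, if in the average $M^{\mathrm{OG}}$ is replaced by $\prod_{t=1}^T h_t(1-Y_t)$ with arbitrary predictable calibrators $h_t$, i.e. calibrators determined by $Y_1,\dots,Y_{t-1}$ (for instance OG calibrators without the range restriction), then the resulting process $M$ still satisfies $Q\bigl(\tfrac1T\log M_T\ge c\bigr)\to1$ for some constant $c>0$, and the online test based on it is consistent at every level $\alpha\in(0,1)$. -/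

import Mathlib

open MeasureTheory ProbabilityTheory Filter Topology Set

namespace Watermark

/-- `Y` is strictly super-uniform under `Q`: `Q(Y ≤ y) < y` for every `y ∈ (0,1)`. -/
def StrictlySuperUniform {Ω : Type*} [MeasurableSpace Ω] (Q : Measure Ω) (Y : Ω → ℝ) : Prop :=
  ∀ y ∈ Ioo (0 : ℝ) 1, Q {ω | Y ω ≤ y} < ENNReal.ofReal y

/-- The uniform distribution `U` on `[0,1]`. -/
noncomputable def uniform01 : Measure ℝ := volume.restrict (Icc (0 : ℝ) 1)

/-- Calibrators: decreasing nonnegative functions on `[0,1]` with integral one. The value at the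
null point `0` only has to be nonnegative, so that functions with `g(0+) = ∞`, such as `-log`,
are included, whatever real number stands for their value at `0`. -/
structure IsCalibrator (g : ℝ → ℝ) : Prop where
  nonneg : ∀ p ∈ Icc (0 : ℝ) 1, 0 ≤ g p
  antitone : AntitoneOn g (Ioc (0 : ℝ) 1)
  integral_eq_one : ∫ p in Icc (0 : ℝ) 1, g p = 1

/-- A calibrator is nonconstant if it takes two different values inside `(0,1)`; the values at the
end points do not matter, because a calibrator is a density. -/
def Nonconstant (g : ℝ → ℝ) : Prop :=
  ∃ x ∈ Ioo (0 : ℝ) 1, ∃ y ∈ Ioo (0 : ℝ) 1, g x ≠ g y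

/-- Decreasing densities on `[0,1]` with range `[a,b]`. -/
structure IsDecreasingDensityWithRange (a b : ℝ) (f : ℝ → ℝ) : Prop where
  antitone : AntitoneOn f (Icc (0 : ℝ) 1)
  mem_range : ∀ p ∈ Icc (0 : ℝ) 1, f p ∈ Icc a b
  integral_eq_one : ∫ p in Icc (0 : ℝ) 1, f p = 1

section

variable {Ω : Type*}

/-! Throughout, time is shifted by one: `Y i` is the `(i+1)`-st pivotal statistic. Hence a
quantity with index `t` that is chosen before `Y t` is read depends on `Y 0, …, Y (t-1)`. -/

/-- The sigma-algebra generated by `Y 0, …, Y (t-1)`. -/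
@[reducible] def past (Y : ℕ → Ω → ℝ) (t : ℕ) : MeasurableSpace Ω :=
  ⨆ s ∈ Finset.range t, MeasurableSpace.comap (Y s) inferInstance

/-- A random function on `[0,1]` is predictable at time `t` if it is determined by
`Y 0, …, Y (t-1)`. -/
def IsPredictable (Y : ℕ → Ω → ℝ) (t : ℕ) (f : Ω → ℝ → ℝ) : Prop :=
  ∀ p ∈ Icc (0 : ℝ) 1, Measurable[past Y t] fun ω => f ω p

/-- The predictable calibrators at time `t`. -/
def IsPredictableCalibrator (Y : ℕ → Ω → ℝ) (t : ℕ) (f : Ω → ℝ → ℝ) : Prop :=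
  IsPredictable Y t f ∧ ∀ ω, IsCalibrator (f ω)

/-- The process `M_t = ∏_{s < t} f_s(1 - Y_s)`, with `M_0 = 1`. -/
noncomputable def productProcess (Y : ℕ → Ω → ℝ) (f : ℕ → Ω → ℝ → ℝ) (t : ℕ) (ω : Ω) : ℝ :=
  ∏ s ∈ Finset.range t, f s ω (1 - Y s ω)

/-- Empirically adaptive weights: the first weight is `0`, and every later weight is a maximizer
over `[0,γ]` of the past log-wealth `∑_{s < t} log ((1 - l) + l g(1 - Y_s))`, measurable with
respect to the past. -/
structure IsAdaptiveWeight (Y : ℕ → Ω → ℝ) (g : ℝ → ℝ) (γ : ℝ) (lam : ℕ → Ω → ℝ) : Prop where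
  measurable : ∀ t, Measurable[past Y t] (lam t)
  zero : ∀ ω, lam 0 ω = 0
  mem : ∀ t, 1 ≤ t → ∀ ω, lam t ω ∈ Icc 0 γ
  isMaxOn : ∀ t, 1 ≤ t → ∀ ω,
    IsMaxOn (fun l : ℝ => ∑ s ∈ Finset.range t, Real.log ((1 - l) + l * g (1 - Y s ω)))
      (Icc 0 γ) (lam t ω)

/-- The random calibrators `(1 - lam_t) + lam_t g`. -/
def weightedCalibrator (g : ℝ → ℝ) (lam : ℕ → Ω → ℝ) (t : ℕ) (ω : Ω) (p : ℝ) : ℝ :=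
  (1 - lam t ω) + lam t ω * g p

/-- The weight-adaptive e-process with calibrator `g` and weights `lam`. -/
noncomputable def weightAdaptiveProcess (Y : ℕ → Ω → ℝ) (g : ℝ → ℝ) (lam : ℕ → Ω → ℝ) :
    ℕ → Ω → ℝ :=
  productProcess Y (weightedCalibrator g lam)

/-- Log-likelihood of the past data together with one additional p-value equal to `1`. -/
noncomputable def ogObjective (Y : ℕ → Ω → ℝ) (t : ℕ) (ω : Ω) (f : ℝ → ℝ) : ℝ :=
  Real.log (f 1) + ∑ s ∈ Finset.range t, Real.log (f (1 - Y s ω))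

/-- Log-likelihood of the past data together with two additional p-values, `0` and `1`, each of
weight one half. -/
noncomputable def ogObjectiveHalf (Y : ℕ → Ω → ℝ) (t : ℕ) (ω : Ω) (f : ℝ → ℝ) : ℝ :=
  ∑ s ∈ Finset.range t, Real.log (f (1 - Y s ω)) + Real.log (f 0) / 2 + Real.log (f 1) / 2

/-- Online Grenander calibrators with range `[a,b]`: at each time the calibrator maximizes, over
the decreasing densities with range `[a,b]`, one of the two log-likelihoods above (which one may
depend on the time), and it is determined by the past. -/
structure IsOnlineGrenander (Y : ℕ → Ω → ℝ) (a b : ℝ) (f : ℕ → Ω → ℝ → ℝ) : Prop where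
  predictable : ∀ t, IsPredictable Y t (f t)
  mem : ∀ t ω, IsDecreasingDensityWithRange a b (f t ω)
  isMaxOn : ∀ t,
    (∀ ω, IsMaxOn (ogObjective Y t ω) {h | IsDecreasingDensityWithRange a b h} (f t ω)) ∨
    (∀ ω, IsMaxOn (ogObjectiveHalf Y t ω) {h | IsDecreasingDensityWithRange a b h} (f t ω))

/-- The arithmetic average of two processes. -/
noncomputable def averageProcess (M N : ℕ → Ω → ℝ) (t : ℕ) (ω : Ω) : ℝ :=
  (1 / 2) * M t ω + (1 / 2) * N t ω

variable [MeasurableSpace Ω]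

/-- Exponential growth: `(1/T) log M_T` converges in probability to a positive constant. -/
def HasExponentialGrowth (Q : Measure Ω) (M : ℕ → Ω → ℝ) : Prop :=
  ∃ c : ℝ, 0 < c ∧
    TendstoInMeasure Q (fun (T : ℕ) ω => (1 / (T : ℝ)) * Real.log (M T ω)) atTop (fun _ => c)

/-- Growth at least at a positive exponential rate, with probability tending to one. -/
def GrowsExponentiallyAtLeast (Q : Measure Ω) (M : ℕ → Ω → ℝ) : Prop :=
  ∃ c : ℝ, 0 < c ∧
    Tendsto (fun T : ℕ => Q {ω | c ≤ (1 / (T : ℝ)) * Real.log (M T ω)}) atTop (𝓝 1)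

/-- The online test based on `M` is consistent at level `α`: the probability that
`max_{1 ≤ t ≤ T} M_t` is at least `1/α` tends to one as `T → ∞`. -/
def IsConsistent (Q : Measure Ω) (M : ℕ → Ω → ℝ) (α : ℝ) : Prop :=
  Tendsto (fun T : ℕ => Q {ω | ∃ t, 1 ≤ t ∧ t ≤ T ∧ 1 / α ≤ M t ω}) atTop (𝓝 1)

end

end Watermark

/-! Put `X_t = 1 - Y_t`. Both processes are products `∏ f_t(X_t)` in which `f_t` maximizes the past
log-likelihood over a class of calibrators, and both turn out to grow at the best expected
log-return of that class, `sup_f E log f(X)`.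

This rate is positive. By the layer-cake formula, strict super-uniformity makes the mean of every
nonconstant decreasing function of `X` larger than its mean under the uniform law
(`lintegral_uniform_lt`), and a small bet on a bounded payoff of positive mean has a positive
expected log-return (`exists_integral_log_one_add_mul_pos`).

For the weights, `log (1 + g(X))` is integrable because the divergence is finite
(`integrable_log_one_add_of_klDiv`), so the expected log-return `φ(l)` of the weight `l` is finite
and continuous. It has a unique maximizer `l*`, by strict concavity. The empirical objectives are
concave, so the strong law at countably many weights forces `lam_t → l*`
(`tendsto_of_isMaxOn_concave`). As `l* > 0`, the log-return is Lipschitz in the weight near `l*`,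
uniformly in the payoff, and the log-wealth grows like that of the constant weight `l*`
(`exists_tendsto_log_wealth`).

For the Grenander calibrators no limit of `f_t` is needed. A decreasing function with values in a
bounded interval is bracketed by step functions on finitely many bins, and the width of the bracket
in mean is controlled by the largest bin probability, which is small since the law of `X` is
absolutely continuous (`leftSum_le_rightSum_add`, `exists_binProb_le`). The strong law for the
bin frequencies then shows that `f_t` has nearly the optimal expected log-return
(`IsOnlineGrenander.optimalLogReturn_le`). The realized log-returns of the brackets differ from
their conditional means by predictable multiples of centred bin indicators; these are orthogonal,
so their averages vanish in measure (`tendsto_measure_average_predictable`). Working with grid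
values of `f_t` also avoids joint measurability of `f_t` in the sample point and the p-value, which
does not follow from predictability; the Grenander process itself need not be
measurable, and `Q` acts as an outer measure in the definitions of growth and consistency.

The average of two positive processes grows at the larger of the two rates, the average with an
arbitrary nonnegative process grows at least at the rate of the positive one, and a process that
grows exponentially eventually exceeds every level. -/

namespace Watermark

/-! ### Exponential growth, averages and consistency -/

section Growth

variable {Ω : Type*}

/-- No measurability is assumed: `Q` is used as an outer measure. -/
lemma tendsto_measure_one_of_cover [MeasurableSpace Ω] {Q : Measure Ω} [IsProbabilityMeasure Q]
    {A B : ℕ → Set Ω}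
    (hA : Tendsto (fun T => Q (A T)) atTop (𝓝 0))
    (hAB : ∀ᶠ T in atTop, ∀ ω, ω ∈ A T ∨ ω ∈ B T) :
    Tendsto (fun T => Q (B T)) atTop (𝓝 1) := by
  have hlow : Tendsto (fun T => 1 - Q (A T)) atTop (𝓝 1) := by
    simpa using ENNReal.Tendsto.sub (tendsto_const_nhds (x := (1 : ENNReal))) hA
      (Or.inl ENNReal.one_ne_top)
  refine tendsto_of_tendsto_of_tendsto_of_le_of_le' hlow tendsto_const_nhds ?_
    (Eventually.of_forall fun T => prob_le_one)
  filter_upwards [hAB] with T hT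
  rw [tsub_le_iff_right, ← measure_univ (μ := Q)]
  calc Q univ ≤ Q (B T ∪ A T) := measure_mono fun ω _ => (hT ω).symm
    _ ≤ Q (B T) + Q (A T) := measure_union_le _ _

lemma tendstoInMeasure_real_iff [MeasurableSpace Ω] {Q : Measure Ω}
    {F : ℕ → Ω → ℝ} {c : ℝ} :
    TendstoInMeasure Q F atTop (fun _ => c) ↔
      ∀ ε > 0, Tendsto (fun T => Q {ω | ε ≤ |F T ω - c|}) atTop (𝓝 0) := by
  simp only [tendstoInMeasure_iff_norm, Real.norm_eq_abs]

lemma HasExponentialGrowth.growsExponentiallyAtLeast [MeasurableSpace Ω] {Q : Measure Ω}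
    [IsProbabilityMeasure Q]
    {M : ℕ → Ω → ℝ}
    (hM : HasExponentialGrowth Q M) : GrowsExponentiallyAtLeast Q M := by
  obtain ⟨c, hc, hM⟩ := hM
  refine ⟨c / 2, by positivity, ?_⟩
  refine tendsto_measure_one_of_cover (tendstoInMeasure_real_iff.1 hM (c / 2) (by positivity)) ?_
  refine Eventually.of_forall fun T ω => ?_
  simp only [mem_ofPred_eq]
  by_contra! h
  have := (abs_lt.1 h.1).1
  linarith [h.2]

lemma GrowsExponentiallyAtLeast.isConsistent [MeasurableSpace Ω] {Q : Measure Ω}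
    [IsProbabilityMeasure Q]
    {M : ℕ → Ω → ℝ} (hM0 : ∀ t ω, 0 ≤ M t ω)
    (hM : GrowsExponentiallyAtLeast Q M) {α : ℝ} (hα : 0 < α) : IsConsistent Q M α := by
  obtain ⟨c, hc, hM⟩ := hM
  refine tendsto_of_tendsto_of_tendsto_of_le_of_le' hM tendsto_const_nhds ?_
    (Eventually.of_forall fun T => prob_le_one)
  have hlarge : Tendsto (fun T : ℕ => c * (T : ℝ)) atTop atTop :=
    tendsto_natCast_atTop_atTop.const_mul_atTop hc
  filter_upwards [hlarge.eventually_ge_atTop (Real.log (1 / α)), eventually_ge_atTop 1]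
    with T hT hT1
  refine measure_mono fun ω hω => ⟨T, hT1, le_rfl, ?_⟩
  have hT0 : (0 : ℝ) < T := by exact_mod_cast hT1
  have h1 : c * T ≤ Real.log (M T ω) := by
    have h2 : c ≤ 1 / (T : ℝ) * Real.log (M T ω) := hω
    rw [one_div, inv_mul_eq_div, le_div_iff₀ hT0] at h2
    exact h2
  -- `log 0 = 0` rules out the value zero.
  have hpos : 0 < M T ω := by
    rcases (hM0 T ω).lt_or_eq with h | h
    · exact h
    · rw [← h, Real.log_zero] at h1
      have : 0 < c * T := by positivity
      linarith
  exact (Real.log_le_log_iff (by positivity) hpos).1 (hT.trans h1)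

lemma averageProcess_nonneg {M N : ℕ → Ω → ℝ} (hM : ∀ t ω, 0 ≤ M t ω) (hN : ∀ t ω, 0 ≤ N t ω)
    (t : ℕ) (ω : Ω) : 0 ≤ averageProcess M N t ω := by
  have := hM t ω
  have := hN t ω
  unfold averageProcess
  positivity

lemma log_le_log_averageProcess {M N : ℕ → Ω → ℝ} (hM : ∀ t ω, 0 < M t ω)
    (hN : ∀ t ω, 0 ≤ N t ω) (t : ℕ) (ω : Ω) :
    Real.log (M t ω) - Real.log 2 ≤ Real.log (averageProcess M N t ω) := by
  rw [← Real.log_div (hM t ω).ne' two_ne_zero]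
  refine Real.log_le_log (div_pos (hM t ω) two_pos) ?_
  unfold averageProcess
  linarith [hN t ω]

lemma averageProcess_comm (M N : ℕ → Ω → ℝ) : averageProcess M N = averageProcess N M := by
  funext t ω
  unfold averageProcess
  ring

/-- The larger of the two exponential rates is the rate of the average. -/
lemma HasExponentialGrowth.average [MeasurableSpace Ω] {Q : Measure Ω}
    {M N : ℕ → Ω → ℝ} (hM0 : ∀ t ω, 0 < M t ω)
    (hN0 : ∀ t ω, 0 < N t ω) (hM : HasExponentialGrowth Q M) (hN : HasExponentialGrowth Q N) :
    HasExponentialGrowth Q (averageProcess M N) := by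
  obtain ⟨c, hc, hM⟩ := hM
  obtain ⟨d, hd, hN⟩ := hN
  refine ⟨max c d, lt_max_of_lt_left hc, tendstoInMeasure_real_iff.2 fun ε hε => ?_⟩
  have hM' := tendstoInMeasure_real_iff.1 hM (ε / 2) (by positivity)
  have hN' := tendstoInMeasure_real_iff.1 hN (ε / 2) (by positivity)
  have hsum := hM'.add hN'
  rw [add_zero] at hsum
  refine tendsto_of_tendsto_of_tendsto_of_le_of_le' tendsto_const_nhds hsum
    (Eventually.of_forall fun T => zero_le) ?_
  have hlog2 : Tendsto (fun T : ℕ => Real.log 2 / (T : ℝ)) atTop (𝓝 0) :=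
    tendsto_const_nhds.div_atTop tendsto_natCast_atTop_atTop
  filter_upwards [hlog2.eventually_lt_const (by positivity : 0 < ε / 2), eventually_ge_atTop 1]
    with T hT hT1
  have hT0 : (0 : ℝ) < T := by exact_mod_cast hT1
  refine (measure_mono fun ω hω => ?_).trans (measure_union_le _ _)
  by_contra hcon
  simp only [mem_union, mem_ofPred_eq, not_or, not_le] at hcon hω
  have h1 := log_le_log_averageProcess hM0 (fun t ω => (hN0 t ω).le) T ω
  have h2 := log_le_log_averageProcess hN0 (fun t ω => (hM0 t ω).le) T ω
  rw [averageProcess_comm] at h2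
  have h3 : Real.log (averageProcess M N T ω) ≤ max (Real.log (M T ω)) (Real.log (N T ω)) := by
    have hM1 := hM0 T ω
    have hN1 := hN0 T ω
    rcases le_total (M T ω) (N T ω) with h | h
    · refine le_max_of_le_right (Real.log_le_log ?_ ?_) <;> unfold averageProcess
      · positivity
      · linarith
    · refine le_max_of_le_left (Real.log_le_log ?_ ?_) <;> unfold averageProcess
      · positivity
      · linarith
  have hscale : ∀ x y : ℝ, x ≤ y → 1 / (T : ℝ) * x ≤ 1 / (T : ℝ) * y := fun x y hxy =>
    mul_le_mul_of_nonneg_left hxy (by positivity)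
  have h1' := hscale _ _ h1
  have h2' := hscale _ _ h2
  have h3' := hscale _ _ h3
  rw [mul_max_of_nonneg _ _ (by positivity)] at h3'
  rw [mul_sub, one_div_mul_eq_div (T : ℝ) (Real.log 2)] at h1' h2'
  obtain ⟨ha, hb⟩ := hcon
  rw [abs_lt] at ha hb
  have hlog2pos : 0 < Real.log 2 := Real.log_pos one_lt_two
  have : |1 / (T : ℝ) * Real.log (averageProcess M N T ω) - max c d| < ε := by
    rw [abs_lt]
    constructor
    · rcases max_choice c d with h | h <;> rw [h] <;> linarith
    · rcases max_choice (1 / (T : ℝ) * Real.log (M T ω)) (1 / (T : ℝ) * Real.log (N T ω))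
        with h | h <;> rw [h] at h3' <;> linarith [le_max_left c d, le_max_right c d]
  linarith

lemma GrowsExponentiallyAtLeast.average [MeasurableSpace Ω] {Q : Measure Ω} [IsProbabilityMeasure Q]
    {M N : ℕ → Ω → ℝ} (hM0 : ∀ t ω, 0 < M t ω)
    (hN0 : ∀ t ω, 0 ≤ N t ω) (hM : GrowsExponentiallyAtLeast Q M) :
    GrowsExponentiallyAtLeast Q (averageProcess M N) := by
  obtain ⟨c, hc, hM⟩ := hM
  refine ⟨c / 2, by positivity, ?_⟩
  refine tendsto_of_tendsto_of_tendsto_of_le_of_le' hM tendsto_const_nhds ?_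
    (Eventually.of_forall fun T => prob_le_one)
  have hlog2 : Tendsto (fun T : ℕ => Real.log 2 / (T : ℝ)) atTop (𝓝 0) :=
    tendsto_const_nhds.div_atTop tendsto_natCast_atTop_atTop
  filter_upwards [hlog2.eventually_lt_const (by positivity : 0 < c / 2)] with T hT
  refine measure_mono fun ω hω => ?_
  simp only [mem_ofPred_eq] at hω ⊢
  have h1 := mul_le_mul_of_nonneg_left (log_le_log_averageProcess hM0 hN0 T ω)
    (by positivity : (0 : ℝ) ≤ 1 / T)
  rw [mul_sub, one_div_mul_eq_div (T : ℝ) (Real.log 2)] at h1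
  linarith

end Growth

/-! ### Small bets on a favourable payoff -/

section SmallBets

variable {Ω : Type*} [MeasurableSpace Ω] {Q : Measure Ω} [IsProbabilityMeasure Q]

lemma sub_two_mul_sq_le_log_one_add {x : ℝ} (hx : |x| ≤ 1 / 2) :
    x - 2 * x ^ 2 ≤ Real.log (1 + x) := by
  obtain ⟨h1, h2⟩ := abs_le.1 hx
  have hpos : 0 < 1 + x := by linarith
  refine le_trans ?_ (Real.one_sub_inv_le_log_of_pos hpos)
  have : 1 - (1 + x)⁻¹ - (x - 2 * x ^ 2) = x ^ 2 * (1 + 2 * x) / (1 + x) := by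
    field_simp
    ring
  have h3 : 0 ≤ x ^ 2 * (1 + 2 * x) / (1 + x) :=
    div_nonneg (mul_nonneg (sq_nonneg x) (by linarith)) hpos.le
  linarith

/-- A small bet on a bounded payoff with positive mean has a positive expected log-return. -/
lemma exists_integral_log_one_add_mul_pos {W : Ω → ℝ} (hW : Measurable W) {K : ℝ}
    (hK : ∀ ω, |W ω| ≤ K) (hmean : 0 < ∫ ω, W ω ∂Q) {l₀ : ℝ} (hl₀ : 0 < l₀) :
    ∃ l, 0 < l ∧ l ≤ l₀ ∧ l * K ≤ 1 / 2 ∧ 0 < ∫ ω, Real.log (1 + l * W ω) ∂Q := by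
  obtain ⟨ω₀⟩ : Nonempty Ω := Q.nonempty_of_neZero
  have hK0 : 0 ≤ K := (abs_nonneg _).trans (hK ω₀)
  set m := ∫ ω, W ω ∂Q with hm
  -- The choice of `l` makes `l * m` exceed the quadratic error `2 * (l * K) ^ 2`.
  set l := min l₀ (min (1 / (2 * (K + 1))) (m / (4 * (K + 1) ^ 2))) with hl
  have hlpos : 0 < l := by
    simp only [hl, lt_min_iff]
    exact ⟨hl₀, by positivity, by positivity⟩
  have hl1 : l * (K + 1) ≤ 1 / 2 := by
    have h : l ≤ 1 / (2 * (K + 1)) := (min_le_right _ _).trans (min_le_left _ _)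
    rw [le_div_iff₀ (by positivity)] at h
    linarith
  have hl2 : l * (4 * (K + 1) ^ 2) ≤ m := by
    have h : l ≤ m / (4 * (K + 1) ^ 2) := (min_le_right _ _).trans (min_le_right _ _)
    rwa [le_div_iff₀ (by positivity)] at h
  refine ⟨l, hlpos, min_le_left _ _, by linarith, ?_⟩
  have hWint : Integrable W Q :=
    Integrable.of_bound hW.aestronglyMeasurable K (Eventually.of_forall hK)
  have habs : ∀ ω, |l * W ω| ≤ 1 / 2 := fun ω => by
    rw [abs_mul, abs_of_pos hlpos]
    nlinarith [hK ω]
  have hlogint : Integrable (fun ω => Real.log (1 + l * W ω)) Q := by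
    refine Integrable.of_bound (C := 1) (Real.measurable_log.comp
      (measurable_const.add (hW.const_mul l))).aestronglyMeasurable
      (Eventually.of_forall fun ω => ?_)
    have h1 := sub_two_mul_sq_le_log_one_add (habs ω)
    obtain ⟨h2, h3⟩ := abs_le.1 (habs ω)
    have h4 : Real.log (1 + l * W ω) ≤ l * W ω := by
      have := Real.log_le_sub_one_of_pos (show 0 < 1 + l * W ω by linarith)
      linarith
    rw [Real.norm_eq_abs, abs_le]
    constructor <;> nlinarith
  have hle : ∫ ω, (l * W ω - 2 * (l * K) ^ 2) ∂Q ≤ ∫ ω, Real.log (1 + l * W ω) ∂Q := by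
    refine integral_mono ((hWint.const_mul l).sub (integrable_const _)) hlogint fun ω => ?_
    refine le_trans ?_ (sub_two_mul_sq_le_log_one_add (habs ω))
    have : (l * W ω) ^ 2 ≤ (l * K) ^ 2 := by
      rw [sq_le_sq, abs_mul, abs_mul, abs_of_nonneg hK0]
      exact mul_le_mul_of_nonneg_left (hK ω) (abs_nonneg l)
    simp only
    linarith
  rw [integral_sub (hWint.const_mul l) (integrable_const _), integral_const_mul,
    integral_const] at hle
  simp only [probReal_univ, smul_eq_mul, one_mul] at hle
  refine lt_of_lt_of_le ?_ hle
  have h5 : 2 * (l * K) ^ 2 < l * m := by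
    have h6 : (l * K) ^ 2 ≤ (l * (K + 1)) ^ 2 := by
      have : l * K ≤ l * (K + 1) := by nlinarith
      exact pow_le_pow_left₀ (by positivity) this 2
    have h7 : l * (l * (4 * (K + 1) ^ 2)) ≤ l * m := mul_le_mul_of_nonneg_left hl2 hlpos.le
    have h8 : 0 < (l * (K + 1)) ^ 2 := by positivity
    nlinarith
  linarith

end SmallBets

/-! ### A law of large numbers for predictable weights -/

section Orthogonality

variable {Ω : Type*} {Y : ℕ → Ω → ℝ}

lemma past_le [MeasurableSpace Ω]
    (hY : ∀ t, Measurable (Y t)) (t : ℕ) :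
    past Y t ≤ (inferInstance : MeasurableSpace Ω) :=
  iSup₂_le fun s _ => (hY s).comap_le

lemma past_mono {s t : ℕ} (hst : s ≤ t) : past Y s ≤ past Y t :=
  biSup_mono fun _ hi => Finset.mem_range.2 ((Finset.mem_range.1 hi).trans_le hst)

lemma measurable_past {s t : ℕ} (hst : s < t) : Measurable[past Y t] (Y s) := by
  rw [measurable_iff_comap_le]
  exact le_iSup₂_of_le s (Finset.mem_range.2 hst) le_rfl

lemma indepFun_past [MeasurableSpace Ω] {Q : Measure Ω}
    (hY : ∀ t, Measurable (Y t)) (hind : iIndepFun Y Q) {t : ℕ} {W : Ω → ℝ}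
    (hW : Measurable[past Y t] W) {u : ℝ → ℝ} (hu : Measurable u) :
    IndepFun W (fun ω => u (Y t ω)) Q := by
  rw [IndepFun_iff_Indep]
  have h := indep_iSup_of_disjoint (fun i => (hY i).comap_le) hind
    (S := {s | s < t}) (T := {t}) (by simp)
  refine indep_of_indep_of_le_left (indep_of_indep_of_le_right h ?_) ?_
  · rw [← measurable_iff_comap_le]
    refine hu.comp (measurable_iff_comap_le.2 ?_)
    simp
  · rw [← measurable_iff_comap_le]
    have hpast : (⨆ i ∈ {s | s < t}, MeasurableSpace.comap (Y i) inferInstance) = past Y t := by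
      simp only [past, Finset.mem_range, mem_ofPred_eq]
    rw [hpast]
    exact hW

/-- Predictable multiples of a centred function of the data are orthogonal, so that the second
moment of their sum grows only linearly. -/
lemma integral_sq_sum_le [MeasurableSpace Ω] {Q : Measure Ω} [IsProbabilityMeasure Q]
    (hY : ∀ t, Measurable (Y t)) (hind : iIndepFun Y Q)
    (hid : ∀ t, IdentDistrib (Y t) (Y 0) Q Q) {W : ℕ → Ω → ℝ}
    (hW : ∀ t, Measurable[past Y t] (W t)) {C : ℝ} (hC : ∀ t ω, |W t ω| ≤ C)
    {u : ℝ → ℝ} (hu : Measurable u) (hu1 : ∀ y, |u y| ≤ 1) (hu0 : ∫ ω, u (Y 0 ω) ∂Q = 0) (T : ℕ) :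
    ∫ ω, (∑ t ∈ Finset.range T, W t ω * u (Y t ω)) ^ 2 ∂Q ≤ C ^ 2 * T := by
  have hmeas : ∀ T, Measurable[past Y T]
      fun ω => ∑ t ∈ Finset.range T, W t ω * u (Y t ω) := fun T =>
    Finset.measurable_sum _ fun t ht => by
      have ht' := Finset.mem_range.1 ht
      exact ((hW t).mono (past_mono ht'.le) le_rfl).mul (hu.comp (measurable_past ht'))
  have hWu : ∀ t ω, |W t ω * u (Y t ω)| ≤ C := fun t ω => by
    rw [abs_mul]
    nlinarith [hC t ω, hu1 (Y t ω), abs_nonneg (W t ω), abs_nonneg (u (Y t ω))]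
  have hbd : ∀ T ω, |∑ t ∈ Finset.range T, W t ω * u (Y t ω)| ≤ T * C := fun T ω => by
    refine (Finset.abs_sum_le_sum_abs _ _).trans ?_
    refine (Finset.sum_le_sum fun t _ => hWu t ω).trans ?_
    simp
  induction T with
  | zero => simp
  | succ T ih =>
    set S := fun ω => ∑ t ∈ Finset.range T, W t ω * u (Y t ω) with hS
    have hSm : Measurable S := (hmeas T).mono (past_le hY T) le_rfl
    have hWm : Measurable (W T) := (hW T).mono (past_le hY T) le_rfl
    have hum : Measurable fun ω => u (Y T ω) := hu.comp (hY T)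
    have hexp : ∀ ω, (∑ t ∈ Finset.range (T + 1), W t ω * u (Y t ω)) ^ 2
        = S ω ^ 2 + 2 * ((S ω * W T ω) * u (Y T ω)) + (W T ω * u (Y T ω)) ^ 2 := fun ω => by
      rw [Finset.sum_range_succ]
      ring
    have hcross : ∫ ω, (S ω * W T ω) * u (Y T ω) ∂Q = 0 := by
      have hind' := indepFun_past hY hind ((hmeas T).mul (hW T)) hu
      have h := hind'.integral_mul_eq_mul_integral (hSm.mul hWm).aestronglyMeasurable
        hum.aestronglyMeasurable
      have h0 : ∫ ω, u (Y T ω) ∂Q = 0 := by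
        rw [← hu0]
        exact ((hid T).comp hu).integral_eq
      rw [h0, mul_zero] at h
      exact h
    have hC0 : 0 ≤ C := (abs_nonneg _).trans (hC 0 (Q.nonempty_of_neZero).some)
    have hi1 : Integrable (fun ω => S ω ^ 2) Q := by
      refine Integrable.of_bound (C := (T * C) ^ 2) (by fun_prop) (Eventually.of_forall fun ω => ?_)
      rw [Real.norm_eq_abs, abs_pow]
      exact pow_le_pow_left₀ (abs_nonneg _) (hbd T ω) 2
    have hi2 : Integrable (fun ω => 2 * ((S ω * W T ω) * u (Y T ω))) Q := by
      refine Integrable.const_mul ?_ 2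
      refine Integrable.of_bound (C := (T * C) * C) (by fun_prop) (Eventually.of_forall fun ω => ?_)
      rw [Real.norm_eq_abs, mul_assoc, abs_mul]
      exact mul_le_mul (hbd T ω) (hWu T ω) (abs_nonneg _) (by positivity)
    have hi3 : Integrable (fun ω => (W T ω * u (Y T ω)) ^ 2) Q := by
      refine Integrable.of_bound (C := C ^ 2) (by fun_prop) (Eventually.of_forall fun ω => ?_)
      rw [Real.norm_eq_abs, abs_pow]
      exact pow_le_pow_left₀ (abs_nonneg _) (hWu T ω) 2
    have hlast : ∫ ω, (W T ω * u (Y T ω)) ^ 2 ∂Q ≤ C ^ 2 := by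
      have h := integral_mono hi3 (integrable_const (C ^ 2)) fun ω => by
        show (W T ω * u (Y T ω)) ^ 2 ≤ C ^ 2
        rw [← sq_abs]
        exact pow_le_pow_left₀ (abs_nonneg _) (hWu T ω) 2
      simpa using h
    simp only [hexp]
    have hi12 : Integrable (fun ω => S ω ^ 2 + 2 * ((S ω * W T ω) * u (Y T ω))) Q := hi1.add hi2
    rw [integral_add hi12 hi3, integral_add hi1 hi2, integral_const_mul, hcross]
    push_cast
    linarith

/-- A weak law of large numbers for predictable multiples of a centred function of the data. -/
lemma tendsto_measure_average_predictable [MeasurableSpace Ω] {Q : Measure Ω}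
    [IsProbabilityMeasure Q]
    (hY : ∀ t, Measurable (Y t)) (hind : iIndepFun Y Q)
    (hid : ∀ t, IdentDistrib (Y t) (Y 0) Q Q) {W : ℕ → Ω → ℝ}
    (hW : ∀ t, Measurable[past Y t] (W t)) {C : ℝ} (hC : ∀ t ω, |W t ω| ≤ C)
    {u : ℝ → ℝ} (hu : Measurable u) (hu1 : ∀ y, |u y| ≤ 1) (hu0 : ∫ ω, u (Y 0 ω) ∂Q = 0) :
    TendstoInMeasure Q (fun (T : ℕ) ω => 1 / (T : ℝ) * ∑ t ∈ Finset.range T, W t ω * u (Y t ω))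
      atTop (fun _ => 0) := by
  refine tendstoInMeasure_real_iff.2 fun ε hε => ?_
  have hWm : ∀ t, Measurable (W t) := fun t => (hW t).mono (past_le hY t) le_rfl
  have hlim : Tendsto (fun T : ℕ => ENNReal.ofReal (C ^ 2 / ε ^ 2 / (T : ℝ))) atTop (𝓝 0) := by
    rw [← ENNReal.ofReal_zero]
    exact ENNReal.tendsto_ofReal (tendsto_const_nhds.div_atTop tendsto_natCast_atTop_atTop)
  refine tendsto_of_tendsto_of_tendsto_of_le_of_le' tendsto_const_nhds hlim
    (Eventually.of_forall fun T => zero_le) ?_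
  filter_upwards [eventually_ge_atTop 1] with T hT1
  have hT0 : (0 : ℝ) < T := by exact_mod_cast hT1
  set S := fun ω => ∑ t ∈ Finset.range T, W t ω * u (Y t ω) with hS
  have hSm : Measurable S := Finset.measurable_sum _ fun t _ => (hWm t).mul (hu.comp (hY t))
  have hWu : ∀ t ω, |W t ω * u (Y t ω)| ≤ C := fun t ω => by
    rw [abs_mul]
    nlinarith [hC t ω, hu1 (Y t ω), abs_nonneg (W t ω), abs_nonneg (u (Y t ω))]
  have hint : Integrable (fun ω => S ω ^ 2) Q := by
    refine Integrable.of_bound (C := (T * C) ^ 2) (by fun_prop) (Eventually.of_forall fun ω => ?_)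
    rw [Real.norm_eq_abs, abs_pow]
    refine pow_le_pow_left₀ (abs_nonneg _) ?_ 2
    refine (Finset.abs_sum_le_sum_abs _ _).trans ?_
    refine (Finset.sum_le_sum fun t _ => hWu t ω).trans ?_
    simp
  have hmarkov := mul_meas_ge_le_integral_of_nonneg
    (Eventually.of_forall fun ω => sq_nonneg (S ω)) hint ((ε * T) ^ 2)
  have hsq := hmarkov.trans (integral_sq_sum_le hY hind hid hW hC hu hu1 hu0 T)
  have hreal : Q.real {ω | (ε * T) ^ 2 ≤ S ω ^ 2} ≤ C ^ 2 / ε ^ 2 / T := by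
    rw [div_div, le_div_iff₀ (by positivity)]
    have : T * (Q.real {ω | (ε * T) ^ 2 ≤ S ω ^ 2} * (ε ^ 2 * T)) ≤ T * C ^ 2 := by
      linarith
    exact le_of_mul_le_mul_left this hT0
  have hsub : {ω | ε ≤ |1 / (T : ℝ) * S ω - 0|} ⊆ {ω | (ε * T) ^ 2 ≤ S ω ^ 2} := fun ω hω => by
    simp only [mem_ofPred_eq, sub_zero, abs_mul] at hω ⊢
    rw [abs_of_pos (by positivity : (0 : ℝ) < 1 / T), one_div_mul_eq_div, le_div_iff₀ hT0] at hω
    rw [← sq_abs (S ω)]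
    exact pow_le_pow_left₀ (by positivity) hω 2
  refine (measure_mono hsub).trans ?_
  rw [← ofReal_measureReal]
  exact ENNReal.ofReal_le_ofReal hreal

end Orthogonality

/-! ### Comparison with the uniform law -/

section Comparison

instance : IsProbabilityMeasure uniform01 := ⟨by simp [uniform01]⟩

variable {Ω : Type*} [MeasurableSpace Ω] {Q : Measure Ω}

lemma measure_eq_zero_of_absolutelyContinuous {Y : Ω → ℝ} (hY : Measurable Y)
    (hac : Q.map Y ≪ uniform01) (y : ℝ) : Q {ω | Y ω = y} = 0 := by
  have h := hac (show uniform01 {y} = 0 by simp [uniform01])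
  rwa [Measure.map_apply hY (measurableSet_singleton y)] at h

variable [IsProbabilityMeasure Q] {Y : Ω → ℝ}

lemma ofReal_lt_measure_one_sub (hY : Measurable Y) (hY01 : ∀ ω, Y ω ∈ Icc (0 : ℝ) 1)
    (hsuper : StrictlySuperUniform Q Y) (hac : Q.map Y ≪ uniform01) {d : ℝ}
    (hd : d ∈ Ioo (0 : ℝ) 1) : ENNReal.ofReal d < Q {ω | 1 - Y ω ∈ Ioo 0 d} := by
  have hlt := hsuper (1 - d) ⟨by linarith [hd.2], by linarith [hd.1]⟩
  have hcover : (univ : Set Ω) ⊆ {ω | Y ω ≤ 1 - d} ∪ ({ω | 1 - Y ω ∈ Ioo 0 d} ∪ {ω | Y ω = 1}) := by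
    intro ω _
    simp only [mem_union, mem_ofPred_eq, mem_Ioo]
    by_cases h1 : Y ω ≤ 1 - d
    · exact Or.inl h1
    · rcases (hY01 ω).2.lt_or_eq with h2 | h2
      · exact Or.inr (Or.inl ⟨by linarith, by linarith⟩)
      · exact Or.inr (Or.inr h2)
  have hle : 1 ≤ Q {ω | Y ω ≤ 1 - d} + Q {ω | 1 - Y ω ∈ Ioo 0 d} := by
    calc 1 = Q univ := measure_univ.symm
      _ ≤ _ := measure_mono hcover
      _ ≤ _ := measure_union_le _ _
      _ ≤ Q {ω | Y ω ≤ 1 - d} + (Q {ω | 1 - Y ω ∈ Ioo 0 d} + Q {ω | Y ω = 1}) := by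
        gcongr
        exact measure_union_le _ _
      _ = _ := by rw [measure_eq_zero_of_absolutelyContinuous hY hac, add_zero]
  by_contra! hcon
  have h1 : (1 : ENNReal) = ENNReal.ofReal (1 - d) + ENNReal.ofReal d := by
    rw [← ENNReal.ofReal_add (by linarith [hd.2]) hd.1.le]
    simp
  have h2 : Q {ω | Y ω ≤ 1 - d} + Q {ω | 1 - Y ω ∈ Ioo 0 d} < 1 := by
    rw [h1]
    exact ENNReal.add_lt_add_of_lt_of_le (measure_ne_top _ _) hlt hcon
  exact absurd hle (not_le.2 h2)

/-- The reflected statistic puts more mass than the uniform law on every set that is a lower set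
of `(0,1]`; the layer-cake formula is applied to the superlevel sets of a decreasing function. -/
lemma uniform_superlevel_le (hY : Measurable Y) (hY01 : ∀ ω, Y ω ∈ Icc (0 : ℝ) 1)
    (hsuper : StrictlySuperUniform Q Y) (hac : Q.map Y ≪ uniform01) {g : ℝ → ℝ}
    (hg : AntitoneOn g (Ioc (0 : ℝ) 1)) (s : ℝ) :
    uniform01 {p | s < g p} ≤ Q {ω | s < g (1 - Y ω)} ∧
      ∀ x ∈ Ioo (0 : ℝ) 1, ∀ y ∈ Ioo (0 : ℝ) 1, s < g x → g y ≤ s →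
        uniform01 {p | s < g p} < Q {ω | s < g (1 - Y ω)} := by
  set B := {p | p ∈ Ioc (0 : ℝ) 1 ∧ s < g p} with hB
  have hBbdd : BddAbove B := ⟨1, fun p hp => hp.1.2⟩
  set d := sSup B with hd
  have hU : uniform01 {p | s < g p} ≤ ENNReal.ofReal d := by
    rw [uniform01, Measure.restrict_apply' measurableSet_Icc]
    have hsub : {p | s < g p} ∩ Icc (0 : ℝ) 1 ⊆ Icc 0 d ∪ {0} := by
      rintro p ⟨hp, hp01⟩
      rcases hp01.1.eq_or_lt with h | h
      · exact Or.inr h.symm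
      · exact Or.inl ⟨h.le, le_csSup hBbdd ⟨⟨h, hp01.2⟩, hp⟩⟩
    refine (measure_mono hsub).trans ((measure_union_le _ _).trans ?_)
    simp
  have hsubQ : ∀ e ≤ d, {ω | 1 - Y ω ∈ Ioo 0 e} ⊆ {ω | s < g (1 - Y ω)} := by
    intro e he ω hω
    obtain ⟨h0, h1⟩ := hω
    have hne : B.Nonempty := by
      by_contra hempty
      rw [not_nonempty_iff_eq_empty] at hempty
      have : d = 0 := by rw [hd, hempty, Real.sSup_empty]
      linarith
    obtain ⟨p, hp, hlt⟩ := exists_lt_of_lt_csSup hne (h1.trans_le he)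
    exact hp.2.trans_le (hg ⟨h0, by linarith [(hY01 ω).1]⟩ hp.1 hlt.le)
  have hd1 : d ≤ 1 := Real.sSup_le (fun p hp => hp.1.2) zero_le_one
  have hd0 : 0 ≤ d := Real.sSup_nonneg fun p hp => hp.1.1.le
  constructor
  · refine hU.trans ?_
    rcases hd0.eq_or_lt with h0 | h0
    · rw [← h0, ENNReal.ofReal_zero]
      exact zero_le
    refine ENNReal.ofReal_le_of_le_toReal ?_
    -- Super-uniformity says nothing at `d = 1`, so `d` is approached from below.
    refine le_of_forall_lt fun e he => ?_
    obtain ⟨e', he0, he1⟩ := exists_between (max_lt he h0)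
    have h := (ofReal_lt_measure_one_sub hY hY01 hsuper hac
      ⟨(le_max_right _ _).trans_lt he0, he1.trans_le hd1⟩).trans_le (measure_mono (hsubQ e' he1.le))
    exact ((le_max_left e 0).trans_lt he0).trans ((ENNReal.ofReal_lt_iff_lt_toReal
      ((le_max_right e 0).trans he0.le) (measure_ne_top _ _)).1 h)
  · intro x hx y hy hgx hgy
    have hxd : x ≤ d := le_csSup hBbdd ⟨⟨hx.1, hx.2.le⟩, hgx⟩
    have hdy : d ≤ y := by
      refine csSup_le ⟨x, ⟨hx.1, hx.2.le⟩, hgx⟩ fun p hp => ?_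
      by_contra! hlt
      exact absurd (hg ⟨hy.1, hy.2.le⟩ hp.1 hlt.le) (not_le.2 (hgy.trans_lt hp.2))
    exact hU.trans_lt ((ofReal_lt_measure_one_sub hY hY01 hsuper hac
      ⟨hx.1.trans_le hxd, hdy.trans_lt hy.2⟩).trans_le (measure_mono (hsubQ d le_rfl)))


/-- Strict super-uniformity makes the mean of every nonconstant decreasing function of the
p-value `1 - Y` larger than its mean under the uniform law. -/
lemma lintegral_uniform_lt (hY : Measurable Y) (hY01 : ∀ ω, Y ω ∈ Icc (0 : ℝ) 1)
    (hsuper : StrictlySuperUniform Q Y) (hac : Q.map Y ≪ uniform01) {g : ℝ → ℝ}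
    (hgm : Measurable g) (hg0 : ∀ p, 0 ≤ g p) (hg : AntitoneOn g (Ioc (0 : ℝ) 1))
    (hgnc : Nonconstant g) (hfin : ∫⁻ p, ENNReal.ofReal (g p) ∂uniform01 ≠ ⊤) :
    ∫⁻ p, ENNReal.ofReal (g p) ∂uniform01 < ∫⁻ ω, ENNReal.ofReal (g (1 - Y ω)) ∂Q := by
  have hgY : Measurable fun ω => g (1 - Y ω) := hgm.comp (measurable_const.sub hY)
  rw [lintegral_eq_lintegral_meas_lt uniform01 (Eventually.of_forall hg0) hgm.aemeasurable]
    at hfin ⊢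
  rw [lintegral_eq_lintegral_meas_lt Q (Eventually.of_forall fun ω => hg0 _) hgY.aemeasurable]
  have hcmp := uniform_superlevel_le hY hY01 hsuper hac hg
  obtain ⟨x, hx, y, hy, hxy⟩ : ∃ x ∈ Ioo (0 : ℝ) 1, ∃ y ∈ Ioo (0 : ℝ) 1, g y < g x := by
    obtain ⟨x, hx, y, hy, hne⟩ := hgnc
    rcases hne.lt_or_gt with h | h
    · exact ⟨y, hy, x, hx, h⟩
    · exact ⟨x, hx, y, hy, h⟩
  have hanti : Antitone fun s : ℝ => Q {ω | s < g (1 - Y ω)} := fun s s' hs =>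
    measure_mono fun ω hω => hs.trans_lt hω
  refine lintegral_strict_mono_of_ae_le_of_ae_lt_on (s := Ioo (g y) (g x))
    hanti.measurable.aemeasurable hfin (Eventually.of_forall fun s => (hcmp s).1) ?_
    (Eventually.of_forall fun s hs => (hcmp s).2 x hx y hy hs.2 hs.1.le)
  have hsub : Ioo (g y) (g x) ⊆ Ioi 0 := fun s hs => (hg0 y).trans_lt hs.1
  rw [Measure.restrict_apply measurableSet_Ioo, inter_eq_left.2 hsub, Real.volume_Ioo]
  simpa using hxy

lemma exists_one_lt_integral_min {Z : Ω → ℝ} (hZ : Measurable Z) (hZ0 : ∀ ω, 0 ≤ Z ω)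
    (h : 1 < ∫⁻ ω, ENNReal.ofReal (Z ω) ∂Q) :
    ∃ K : ℝ, 0 ≤ K ∧ 1 < ∫ ω, min (Z ω) K ∂Q := by
  have hmono : Tendsto (fun n : ℕ => ∫⁻ ω, ENNReal.ofReal (min (Z ω) n) ∂Q) atTop
      (𝓝 (∫⁻ ω, ENNReal.ofReal (Z ω) ∂Q)) := by
    refine lintegral_tendsto_of_tendsto_of_monotone
      (fun n => (hZ.min measurable_const).ennreal_ofReal.aemeasurable)
      (Eventually.of_forall fun ω m n hmn => ?_) (Eventually.of_forall fun ω => ?_)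
    · exact ENNReal.ofReal_le_ofReal (min_le_min le_rfl (by exact_mod_cast hmn))
    · refine tendsto_const_nhds.congr' ?_
      filter_upwards [eventually_ge_atTop ⌈Z ω⌉₊] with n hn
      rw [min_eq_left (Nat.ceil_le.1 hn)]
  obtain ⟨n, hn⟩ := (hmono.eventually_const_lt h).exists
  refine ⟨n, n.cast_nonneg, ?_⟩
  have hnn : ∀ ω, 0 ≤ min (Z ω) n := fun ω => le_min (hZ0 ω) n.cast_nonneg
  have hint : Integrable (fun ω => min (Z ω) (n : ℝ)) Q := by
    refine Integrable.of_bound (C := n) (hZ.min measurable_const).aestronglyMeasurable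
      (Eventually.of_forall fun ω => ?_)
    rw [Real.norm_eq_abs, abs_of_nonneg (hnn ω)]
    exact min_le_right _ _
  rw [← ofReal_integral_eq_lintegral_ofReal hint (Eventually.of_forall hnn)] at hn
  rwa [← ENNReal.ofReal_one, ENNReal.ofReal_lt_ofReal_iff_of_nonneg zero_le_one] at hn

end Comparison

/-! ### Consequences of finite divergence -/

section Divergence

/-- Logarithms of exponentially integrable functions are integrable under a law of finite
divergence. This is one half of the Donsker–Varadhan inequality, in the form
`log (1 + k) ≤ log q + (1 + k) / q` with the density `q`. -/
lemma integrable_log_one_add_of_klDiv {μ ν : Measure ℝ} [IsFiniteMeasure μ] [IsFiniteMeasure ν]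
    (hkl : InformationTheory.klDiv μ ν < ⊤) {k : ℝ → ℝ} (hk : Measurable k) (hk0 : ∀ y, 0 ≤ k y)
    (hfin : ∫⁻ y, ENNReal.ofReal (k y) ∂ν ≠ ⊤) :
    Integrable (fun y => Real.log (1 + k y)) μ := by
  obtain ⟨hac, hllr⟩ := InformationTheory.klDiv_ne_top_iff.1 hkl.ne
  have hq : Measurable (μ.rnDeriv ν) := Measure.measurable_rnDeriv μ ν
  have hratio : Measurable fun y => (1 + k y) / (μ.rnDeriv ν y).toReal :=
    (measurable_const.add hk).div hq.ennreal_toReal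
  have hint : Integrable (fun y => (1 + k y) / (μ.rnDeriv ν y).toReal) μ := by
    refine ⟨hratio.aestronglyMeasurable, ?_⟩
    rw [hasFiniteIntegral_iff_ofReal (Eventually.of_forall fun y =>
      div_nonneg (by linarith [hk0 y]) ENNReal.toReal_nonneg),
      ← lintegral_rnDeriv_mul hac hratio.ennreal_ofReal.aemeasurable]
    calc ∫⁻ y, μ.rnDeriv ν y * ENNReal.ofReal ((1 + k y) / (μ.rnDeriv ν y).toReal) ∂ν
        ≤ ∫⁻ y, (1 + ENNReal.ofReal (k y)) ∂ν := by
          refine lintegral_mono fun y => ?_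
          rw [← ENNReal.ofReal_one, ← ENNReal.ofReal_add zero_le_one (hk0 y)]
          rcases eq_or_ne (μ.rnDeriv ν y).toReal 0 with h0 | h0
          · simp [h0]
          · have htop : μ.rnDeriv ν y ≠ ⊤ := fun h => h0 (by simp [h])
            rw [← ENNReal.ofReal_toReal htop, ← ENNReal.ofReal_mul ENNReal.toReal_nonneg,
              ENNReal.toReal_ofReal ENNReal.toReal_nonneg, mul_div_cancel₀ _ h0]
      _ < ⊤ := by
          rw [lintegral_add_left measurable_const]
          simpa [lt_top_iff_ne_top] using hfin
  refine Integrable.mono' (hllr.abs.add hint)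
    (Real.measurable_log.comp (measurable_const.add hk)).aestronglyMeasurable ?_
  filter_upwards [Measure.rnDeriv_pos hac, hac.ae_le (Measure.rnDeriv_lt_top μ ν)] with y hpos htop
  have hq0 : 0 < (μ.rnDeriv ν y).toReal := ENNReal.toReal_pos hpos.ne' htop.ne
  have hk1 : 0 < 1 + k y := by linarith [hk0 y]
  rw [Real.norm_eq_abs, abs_of_nonneg (Real.log_nonneg (by linarith [hk0 y]))]
  have h1 : Real.log (1 + k y) = Real.log (μ.rnDeriv ν y).toReal
      + Real.log ((1 + k y) / (μ.rnDeriv ν y).toReal) := by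
    rw [Real.log_div hk1.ne' hq0.ne']
    ring
  have h2 := Real.log_le_sub_one_of_pos (div_pos hk1 hq0)
  have h3 := le_abs_self (llr μ ν y)
  simp only [Pi.add_apply, llr_def] at h3 ⊢
  linarith

lemma lintegral_uniform_comp_one_sub (F : ℝ → ENNReal) :
    ∫⁻ y, F (1 - y) ∂uniform01 = ∫⁻ p, F p ∂uniform01 := by
  have h := (Measure.measurePreserving_sub_left (volume : Measure ℝ) 1)
    |>.setLIntegral_comp_preimage_emb (MeasurableEquiv.subLeft (1 : ℝ)).measurableEmbedding
      F (Icc 0 1)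
  have hpre : (fun y : ℝ => 1 - y) ⁻¹' Icc 0 1 = Icc 0 1 := by
    simp
  rw [hpre] at h
  exact h

lemma exists_measure_lt_of_absolutelyContinuous {μ ν : Measure ℝ} [IsFiniteMeasure μ]
    [IsFiniteMeasure ν] (hac : μ ≪ ν) {ε : ENNReal} (hε : ε ≠ 0) :
    ∃ δ > 0, ∀ s, ν s < δ → μ s < ε := by
  have hfin : ∫⁻ y, μ.rnDeriv ν y ∂ν ≠ ⊤ := (Measure.lintegral_rnDeriv_lt_top μ ν).ne
  obtain ⟨δ, hδ, h⟩ := exists_pos_setLIntegral_lt_of_measure_lt hfin hε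
  refine ⟨δ, hδ, fun s hs => ?_⟩
  have := h s hs
  rwa [Measure.setLIntegral_rnDeriv hac] at this

end Divergence

/-! ### Empirically optimal weights -/

section AdaptiveWeights

lemma one_sub_le_mix {γ l z : ℝ} (hl : l ∈ Icc 0 γ) (hz : 0 ≤ z) :
    1 - γ ≤ (1 - l) + l * z := by
  have := mul_nonneg hl.1 hz
  linarith [hl.2]

lemma concaveOn_log_mix {γ z : ℝ} (hγ : γ < 1) (hz : 0 ≤ z) :
    ConcaveOn ℝ (Icc 0 γ) fun l : ℝ => Real.log ((1 - l) + l * z) := by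
  refine ⟨convex_Icc 0 γ, fun l hl m hm p q hp hq hpq => ?_⟩
  have h := strictConcaveOn_log_Ioi.concaveOn.2
    (show (1 - l) + l * z ∈ Ioi 0 by
      have := one_sub_le_mix hl hz
      simp only [mem_Ioi]
      linarith)
    (show (1 - m) + m * z ∈ Ioi 0 by
      have := one_sub_le_mix hm hz
      simp only [mem_Ioi]
      linarith) hp hq hpq
  refine h.trans_eq (congrArg Real.log ?_)
  simp only [smul_eq_mul]
  linear_combination hpq

lemma concaveOn_sum_log_mix {γ : ℝ} (hγ : γ < 1) {z : ℕ → ℝ} (hz : ∀ s, 0 ≤ z s) (T : ℕ) :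
    ConcaveOn ℝ (Icc 0 γ)
      fun l : ℝ => ∑ s ∈ Finset.range T, Real.log ((1 - l) + l * z s) := by
  induction T with
  | zero => simpa using concaveOn_const (0 : ℝ) (convex_Icc 0 γ)
  | succ T ih =>
    simp only [Finset.sum_range_succ]
    exact ih.add (concaveOn_log_mix hγ (hz T))

lemma abs_log_mix_le {γ l z : ℝ} (hγ : γ < 1) (hl : l ∈ Icc 0 γ) (hz : 0 ≤ z) :
    |Real.log ((1 - l) + l * z)| ≤ Real.log (1 + z) - Real.log (1 - γ) := by
  have h1 := one_sub_le_mix hl hz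
  have h2 : (1 - l) + l * z ≤ 1 + z := by nlinarith [hl.1, hl.2]
  have h3 := Real.log_le_log (by linarith) h1
  have h4 := Real.log_le_log (by linarith) h2
  have h5 : 0 ≤ Real.log (1 + z) := Real.log_nonneg (by linarith)
  have h6 : Real.log (1 - γ) ≤ 0 := Real.log_nonpos (by linarith) (by linarith [hl.1, hl.2])
  rw [abs_le]
  constructor <;> linarith

/-- Two weights that are bounded away from zero give close log-returns, uniformly in the payoff,
although the payoff is unbounded. -/
lemma abs_log_mix_sub_le {l m κ z : ℝ} (hκ : 0 < κ) (hz : 0 ≤ z) (hl1 : κ ≤ 1 - l) (hl2 : κ ≤ l)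
    (hm1 : κ ≤ 1 - m) (hm2 : κ ≤ m) :
    |Real.log ((1 - l) + l * z) - Real.log ((1 - m) + m * z)| ≤ |l - m| / κ := by
  have key : ∀ l m : ℝ, κ ≤ 1 - l → κ ≤ l → κ ≤ 1 - m → κ ≤ m →
      Real.log ((1 - l) + l * z) - Real.log ((1 - m) + m * z) ≤ |l - m| / κ := by
    intro l m hl1 hl2 hm1 hm2
    have hL : κ * (1 + z) ≤ (1 - l) + l * z := by nlinarith
    have hM : κ * (1 + z) ≤ (1 - m) + m * z := by nlinarith
    have hκz : 0 < κ * (1 + z) := by positivity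
    rw [← Real.log_div (by linarith) (by linarith)]
    refine (Real.log_le_sub_one_of_pos (div_pos (by linarith) (by linarith))).trans ?_
    have hM0 : 0 < (1 - m) + m * z := by linarith
    rw [div_sub_one hM0.ne', div_le_div_iff₀ hM0 hκ]
    have h1 : (1 - l + l * z - (1 - m + m * z)) ≤ |l - m| * (1 + z) := by
      have h2 : (1 - l + l * z - (1 - m + m * z)) = (l - m) * (z - 1) := by ring
      rw [h2]
      refine (le_abs_self _).trans ?_
      rw [abs_mul]
      refine mul_le_mul_of_nonneg_left ?_ (abs_nonneg _)
      rw [abs_le]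
      constructor <;> linarith
    calc (1 - l + l * z - (1 - m + m * z)) * κ ≤ |l - m| * (1 + z) * κ := by gcongr
      _ = |l - m| * (κ * (1 + z)) := by ring
      _ ≤ |l - m| * (1 - m + m * z) := by gcongr
  rw [abs_le]
  constructor
  · have := key m l hm1 hm2 hl1 hl2
    rw [abs_sub_comm] at this
    linarith
  · exact key l m hl1 hl2 hm1 hm2

/-- Consistency of the empirically optimal weights. The objective is concave, so its maximizer is
located by its values at three points, and the strong law is only needed at countably many. -/
lemma tendsto_of_isMaxOn_concave {γ l : ℝ} (hl : l ∈ Icc 0 γ) (hl0 : 0 < l) {φ : ℝ → ℝ}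
    (hφ : ∀ m ∈ Icc 0 γ, m ≠ l → φ m < φ l) {Ψ : ℕ → ℝ → ℝ}
    (hΨ : ∀ t, ConcaveOn ℝ (Icc 0 γ) (Ψ t))
    (hlim : Tendsto (fun t => Ψ t l / t) atTop (𝓝 (φ l)))
    (hleft : ∀ n : ℕ, Tendsto (fun t => Ψ t (max 0 (l - 1 / (n + 1))) / t) atTop
      (𝓝 (φ (max 0 (l - 1 / (n + 1))))))
    (hright : ∀ n : ℕ, Tendsto (fun t => Ψ t (min γ (l + 1 / (n + 1))) / t) atTop
      (𝓝 (φ (min γ (l + 1 / (n + 1))))))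
    {x : ℕ → ℝ} (hx : ∀ t, 1 ≤ t → x t ∈ Icc 0 γ)
    (hmax : ∀ t, 1 ≤ t → IsMaxOn (Ψ t) (Icc 0 γ) (x t)) : Tendsto x atTop (𝓝 l) := by
  rw [Metric.tendsto_atTop']
  intro ε hε
  obtain ⟨n, hn⟩ := exists_nat_one_div_lt hε
  have hn0 : (0 : ℝ) < 1 / (n + 1) := Nat.one_div_pos_of_nat
  set u := max 0 (l - 1 / ((n : ℝ) + 1)) with hu
  set v := min γ (l + 1 / ((n : ℝ) + 1)) with hv
  have hul : u < l := max_lt hl0 (by linarith)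
  have hlv : l ≤ v := le_min hl.2 (by linarith)
  have huI : u ∈ Icc 0 γ := ⟨le_max_left _ _, hul.le.trans hl.2⟩
  have hvI : v ∈ Icc 0 γ := ⟨hl.1.trans hlv, min_le_left _ _⟩
  have hlt : ∀ w ∈ Icc 0 γ, w ≠ l → Tendsto (fun t => Ψ t w / t) atTop (𝓝 (φ w)) →
      ∀ᶠ t in atTop, Ψ t w < Ψ t l := by
    intro w hw hwl hlimw
    filter_upwards [hlimw.eventually_lt hlim (hφ w hw hwl), eventually_ge_atTop 1] with t ht ht1
    have ht0 : (0 : ℝ) < t := by exact_mod_cast ht1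
    exact (div_lt_div_iff_of_pos_right ht0).1 ht
  have hA : ∀ᶠ t in atTop, u < x t := by
    filter_upwards [hlt u huI hul.ne (hleft n), eventually_ge_atTop 1] with t ht ht1
    by_contra! hcon
    have h1 := (hΨ t).min_le_of_mem_Icc (hx t ht1) hl ⟨hcon, hul.le⟩
    have h2 : Ψ t l ≤ Ψ t (x t) := hmax t ht1 hl
    rw [min_eq_right h2] at h1
    linarith
  have hB : ∀ᶠ t in atTop, x t ≤ v := by
    rcases hlv.eq_or_lt with h | h
    · have hvγ : v = γ := by
        rcases min_choice γ (l + 1 / ((n : ℝ) + 1)) with h' | h' <;> rw [← hv] at h'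
        · exact h'
        · linarith
      filter_upwards [eventually_ge_atTop 1] with t ht1
      rw [hvγ]
      exact (hx t ht1).2
    · filter_upwards [hlt v hvI h.ne' (hright n), eventually_ge_atTop 1] with t ht ht1
      by_contra! hcon
      have h1 := (hΨ t).min_le_of_mem_Icc hl (hx t ht1) ⟨h.le, hcon.le⟩
      have h2 : Ψ t l ≤ Ψ t (x t) := hmax t ht1 hl
      rw [min_eq_left h2] at h1
      linarith
  obtain ⟨N, hN⟩ := eventually_atTop.1 (hA.and hB)
  refine ⟨N, fun t ht => ?_⟩
  obtain ⟨h1, h2⟩ := hN t ht.le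
  rw [Real.dist_eq, abs_lt]
  have h3 : l - 1 / ((n : ℝ) + 1) ≤ u := le_max_right _ _
  have h4 : v ≤ l + 1 / ((n : ℝ) + 1) := min_le_right _ _
  constructor <;> linarith

variable {Ω : Type*} [MeasurableSpace Ω] {Q : Measure Ω}

lemma measurable_log_mix {Z : Ω → ℝ} (hZ : Measurable Z) (l : ℝ) :
    Measurable fun ω => Real.log ((1 - l) + l * Z ω) :=
  Real.measurable_log.comp (measurable_const.add (hZ.const_mul l))

variable [IsProbabilityMeasure Q]

lemma integrable_log_mix {Z : Ω → ℝ} (hZ : Measurable Z) (hZ0 : ∀ ω, 0 ≤ Z ω)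
    (hlog : Integrable (fun ω => Real.log (1 + Z ω)) Q) {γ l : ℝ} (hγ : γ < 1)
    (hl : l ∈ Icc 0 γ) : Integrable (fun ω => Real.log ((1 - l) + l * Z ω)) Q :=
  (hlog.sub (integrable_const (Real.log (1 - γ)))).mono'
    (measurable_log_mix hZ l).aestronglyMeasurable
    (Eventually.of_forall fun ω => abs_log_mix_le hγ hl (hZ0 ω))

lemma exists_integral_log_mix_pos {Z : Ω → ℝ} (hZ : Measurable Z) (hZ0 : ∀ ω, 0 ≤ Z ω)
    (hlog : Integrable (fun ω => Real.log (1 + Z ω)) Q) {K : ℝ} (hK0 : 0 ≤ K)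
    (hK : 1 < ∫ ω, min (Z ω) K ∂Q) {γ : ℝ} (hγ : γ ∈ Ioo (0 : ℝ) 1) :
    ∃ l ∈ Icc 0 γ, 0 < ∫ ω, Real.log ((1 - l) + l * Z ω) ∂Q := by
  have hmm : Measurable fun ω => min (Z ω) K := hZ.min measurable_const
  have hbd : ∀ ω, |min (Z ω) K - 1| ≤ K + 1 := fun ω => by
    have h1 : 0 ≤ min (Z ω) K := le_min (hZ0 ω) hK0
    have h2 : min (Z ω) K ≤ K := min_le_right _ _
    rw [abs_le]
    constructor <;> linarith
  have hint : Integrable (fun ω => min (Z ω) K) Q := by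
    refine Integrable.of_bound (C := K) hmm.aestronglyMeasurable (Eventually.of_forall fun ω => ?_)
    rw [Real.norm_eq_abs, abs_of_nonneg (le_min (hZ0 ω) hK0)]
    exact min_le_right _ _
  have hmean : 0 < ∫ ω, (min (Z ω) K - 1) ∂Q := by
    rw [integral_sub hint (integrable_const _)]
    simpa using hK
  obtain ⟨l, hl0, hlγ, hlK, hpos⟩ := exists_integral_log_one_add_mul_pos (hmm.sub_const 1) hbd
    hmean hγ.1
  refine ⟨l, ⟨hl0.le, hlγ⟩, hpos.trans_le ?_⟩
  have hlow : ∀ ω, 1 / 2 ≤ 1 + l * (min (Z ω) K - 1) := fun ω => by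
    have h1 := mul_le_mul_of_nonneg_left (abs_le.1 (hbd ω)).1 hl0.le
    linarith
  have hcmp : ∀ ω, Real.log (1 + l * (min (Z ω) K - 1)) ≤ Real.log ((1 - l) + l * Z ω) :=
    fun ω => by
      refine Real.log_le_log (by linarith [hlow ω]) ?_
      have := mul_le_mul_of_nonneg_left (min_le_left (Z ω) K) hl0.le
      linarith
  -- A nonzero Bochner integral certifies integrability.
  exact integral_mono (not_imp_comm.1 integral_undef hpos.ne')
    (integrable_log_mix hZ hZ0 hlog hγ.2 ⟨hl0.le, hlγ⟩) hcmp

/-- The expected log-return has only one maximizer if its maximum is positive: by strict concavity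
of the logarithm, two maximizers would force `Z = 1` almost surely. -/
lemma eq_of_isMaxOn_integral_log_mix {Z : Ω → ℝ} (hZ : Measurable Z) (hZ0 : ∀ ω, 0 ≤ Z ω)
    (hlog : Integrable (fun ω => Real.log (1 + Z ω)) Q) {γ : ℝ} (hγ : γ < 1) {l m : ℝ}
    (hl : l ∈ Icc 0 γ) (hm : m ∈ Icc 0 γ)
    (hmax : IsMaxOn (fun l => ∫ ω, Real.log ((1 - l) + l * Z ω) ∂Q) (Icc 0 γ) l)
    (hpos : 0 < ∫ ω, Real.log ((1 - l) + l * Z ω) ∂Q)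
    (heq : ∫ ω, Real.log ((1 - l) + l * Z ω) ∂Q ≤ ∫ ω, Real.log ((1 - m) + m * Z ω) ∂Q) :
    m = l := by
  by_contra hne
  set c := (l + m) / 2 with hc
  have hcI : c ∈ Icc 0 γ := ⟨by linarith [hl.1, hm.1], by linarith [hl.2, hm.2]⟩
  have hil := integrable_log_mix hZ hZ0 hlog hγ hl
  have him := integrable_log_mix hZ hZ0 hlog hγ hm
  have hic := integrable_log_mix hZ hZ0 hlog hγ hcI
  set D := fun ω => Real.log ((1 - c) + c * Z ω) - (1 / 2 * Real.log ((1 - l) + l * Z ω)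
    + 1 / 2 * Real.log ((1 - m) + m * Z ω)) with hD
  have hpl : ∀ ω, (1 - l) + l * Z ω ∈ Ioi 0 := fun ω => by
    have := one_sub_le_mix hl (hZ0 ω)
    simp only [mem_Ioi]
    linarith
  have hpm : ∀ ω, (1 - m) + m * Z ω ∈ Ioi 0 := fun ω => by
    have := one_sub_le_mix hm (hZ0 ω)
    simp only [mem_Ioi]
    linarith
  have hmid : ∀ ω, (1 - c) + c * Z ω
      = (1 / 2 : ℝ) • ((1 - l) + l * Z ω) + (1 / 2 : ℝ) • ((1 - m) + m * Z ω) := fun ω => by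
    simp only [smul_eq_mul, hc]
    ring
  have hD0 : ∀ ω, 0 ≤ D ω := fun ω => by
    have h := strictConcaveOn_log_Ioi.concaveOn.2 (hpl ω) (hpm ω) (by norm_num : (0 : ℝ) ≤ 1 / 2)
      (by norm_num : (0 : ℝ) ≤ 1 / 2) (by norm_num)
    rw [← hmid ω] at h
    simpa [hD] using h
  have hDint : Integrable D Q := hic.sub ((hil.const_mul _).add (him.const_mul _))
  have hDle : ∫ ω, D ω ∂Q ≤ 0 := by
    have h := hmax hcI
    simp only [mem_ofPred_eq] at h
    have hsum : Integrable (fun ω => 1 / 2 * Real.log ((1 - l) + l * Z ω)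
      + 1 / 2 * Real.log ((1 - m) + m * Z ω)) Q := (hil.const_mul _).add (him.const_mul _)
    rw [hD, integral_sub hic hsum, integral_add (hil.const_mul _) (him.const_mul _),
      integral_const_mul, integral_const_mul]
    linarith
  have hDzero := (integral_eq_zero_iff_of_nonneg hD0 hDint).1
    (le_antisymm hDle (integral_nonneg hD0))
  have hZ1 : ∀ᵐ ω ∂Q, Real.log ((1 - l) + l * Z ω) = 0 := by
    filter_upwards [hDzero] with ω hω
    have hxy : (1 - l) + l * Z ω = (1 - m) + m * Z ω := by
      by_contra hxy
      have h := strictConcaveOn_log_Ioi.2 (hpl ω) (hpm ω) hxy (by norm_num : (0 : ℝ) < 1 / 2)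
        (by norm_num : (0 : ℝ) < 1 / 2) (by norm_num)
      rw [← hmid ω] at h
      simp only [hD, smul_eq_mul, Pi.zero_apply] at h hω
      linarith
    have hprod : (l - m) * (Z ω - 1) = 0 := by linear_combination hxy
    rcases mul_eq_zero.1 hprod with h | h
    · exact absurd (by linarith) hne
    · have : (1 - l) + l * Z ω = 1 := by linear_combination l * h
      rw [this, Real.log_one]
  rw [integral_congr_ae hZ1] at hpos
  simp at hpos

lemma continuousOn_integral_log_mix {Z : Ω → ℝ} (hZ : Measurable Z) (hZ0 : ∀ ω, 0 ≤ Z ω)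
    (hlog : Integrable (fun ω => Real.log (1 + Z ω)) Q) {γ : ℝ} (hγ : γ < 1) :
    ContinuousOn (fun l => ∫ ω, Real.log ((1 - l) + l * Z ω) ∂Q) (Icc 0 γ) := by
  refine continuousOn_of_dominated (bound := fun ω => Real.log (1 + Z ω) - Real.log (1 - γ))
    (fun l _ => (measurable_log_mix hZ l).aestronglyMeasurable)
    (fun l hl => Eventually.of_forall fun ω => abs_log_mix_le hγ hl (hZ0 ω))
    (hlog.sub (integrable_const _)) (Eventually.of_forall fun ω => ?_)
  refine ContinuousOn.log (by fun_prop) fun l hl => ?_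
  have := one_sub_le_mix hl (hZ0 ω)
  linarith

/-- The log-wealth of empirically optimal weights grows at the optimal rate. -/
lemma exists_tendsto_log_wealth {Z : ℕ → Ω → ℝ} (hZ : ∀ t, Measurable (Z t))
    (hZ0 : ∀ t ω, 0 ≤ Z t ω) (hind : Pairwise fun s t => IndepFun (Z s) (Z t) Q)
    (hid : ∀ t, IdentDistrib (Z t) (Z 0) Q Q)
    (hlog : Integrable (fun ω => Real.log (1 + Z 0 ω)) Q) {K : ℝ} (hK0 : 0 ≤ K)
    (hK : 1 < ∫ ω, min (Z 0 ω) K ∂Q) {γ : ℝ} (hγ : γ ∈ Ioo (0 : ℝ) 1) {lam : ℕ → Ω → ℝ}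
    (hmem : ∀ t, 1 ≤ t → ∀ ω, lam t ω ∈ Icc 0 γ)
    (hmax : ∀ t, 1 ≤ t → ∀ ω, IsMaxOn
      (fun l : ℝ => ∑ s ∈ Finset.range t, Real.log ((1 - l) + l * Z s ω)) (Icc 0 γ) (lam t ω)) :
    ∃ c : ℝ, 0 < c ∧ ∀ᵐ ω ∂Q, Tendsto (fun T : ℕ =>
      1 / (T : ℝ) * ∑ t ∈ Finset.range T, Real.log ((1 - lam t ω) + lam t ω * Z t ω))
      atTop (𝓝 c) := by
  set φ := fun l : ℝ => ∫ ω, Real.log ((1 - l) + l * Z 0 ω) ∂Q with hφ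
  obtain ⟨l, hl, hlmax⟩ := isCompact_Icc.exists_isMaxOn (nonempty_Icc.2 hγ.1.le)
    (continuousOn_integral_log_mix (hZ 0) (hZ0 0) hlog hγ.2)
  have hφl : 0 < φ l := by
    obtain ⟨m, hm, hpos⟩ := exists_integral_log_mix_pos (hZ 0) (hZ0 0) hlog hK0 hK hγ
    exact hpos.trans_le (hlmax hm)
  have hl0 : 0 < l := by
    refine lt_of_le_of_ne hl.1 fun h => ?_
    simp [hφ, ← h] at hφl
  have huniq : ∀ m ∈ Icc 0 γ, m ≠ l → φ m < φ l := fun m hm hne => by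
    by_contra! hle
    exact hne (eq_of_isMaxOn_integral_log_mix (hZ 0) (hZ0 0) hlog hγ.2 hl hm hlmax hφl hle)
  have hslln : ∀ m ∈ Icc 0 γ, ∀ᵐ ω ∂Q, Tendsto (fun t : ℕ =>
      (∑ s ∈ Finset.range t, Real.log ((1 - m) + m * Z s ω)) / t) atTop (𝓝 (φ m)) := by
    intro m hm
    have hF : Measurable fun z : ℝ => Real.log ((1 - m) + m * z) :=
      measurable_log_mix measurable_id m
    exact strong_law_ae_real (fun t ω => Real.log ((1 - m) + m * Z t ω))
      (integrable_log_mix (hZ 0) (hZ0 0) hlog hγ.2 hm)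
      (fun s t hst => (hind hst).comp hF hF) fun t => (hid t).comp hF
  have hleft : ∀ n : ℕ, max 0 (l - 1 / ((n : ℝ) + 1)) ∈ Icc 0 γ := fun n => by
    have hn0 : (0 : ℝ) < 1 / (n + 1) := Nat.one_div_pos_of_nat
    exact ⟨le_max_left _ _, max_le hγ.1.le (by linarith [hl.2])⟩
  have hright : ∀ n : ℕ, min γ (l + 1 / ((n : ℝ) + 1)) ∈ Icc 0 γ := fun n => by
    have hn0 : (0 : ℝ) < 1 / (n + 1) := Nat.one_div_pos_of_nat
    exact ⟨le_min hγ.1.le (by linarith), min_le_left _ _⟩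
  refine ⟨φ l, hφl, ?_⟩
  filter_upwards [hslln l hl, ae_all_iff.2 fun n => hslln _ (hleft n),
    ae_all_iff.2 fun n => hslln _ (hright n)] with ω h0 h1 h2
  have hlam : Tendsto (fun t => lam t ω) atTop (𝓝 l) :=
    tendsto_of_isMaxOn_concave (Ψ := fun t m => ∑ s ∈ Finset.range t,
      Real.log ((1 - m) + m * Z s ω)) hl hl0 huniq
      (fun t => concaveOn_sum_log_mix hγ.2 (fun s => hZ0 s ω) t) h0 h1 h2
      (fun t ht => hmem t ht ω) fun t ht => hmax t ht ω
  set κ := min (l / 2) (1 - γ) with hκ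
  have hκ0 : 0 < κ := lt_min (by linarith) (by linarith [hγ.2])
  have hκl : κ ≤ l / 2 := min_le_left _ _
  have hκγ : κ ≤ 1 - γ := min_le_right _ _
  have hdiff : Tendsto (fun t => Real.log ((1 - lam t ω) + lam t ω * Z t ω)
      - Real.log ((1 - l) + l * Z t ω)) atTop (𝓝 0) := by
    have hbound : Tendsto (fun t => |lam t ω - l| / κ) atTop (𝓝 0) := by
      have := ((hlam.sub_const l).abs).div_const κ
      simpa using this
    refine squeeze_zero_norm' ?_ hbound
    filter_upwards [hlam.eventually_const_lt (show l / 2 < l by linarith), eventually_ge_atTop 1]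
      with t ht ht1
    rw [Real.norm_eq_abs]
    exact abs_log_mix_sub_le hκ0 (hZ0 t ω) (by linarith [(hmem t ht1 ω).2])
      (by linarith) (by linarith [hl.2]) (by linarith)
  have hsum := hdiff.cesaro.add h0
  rw [zero_add] at hsum
  refine hsum.congr fun T => ?_
  rw [Finset.sum_sub_distrib]
  ring

end AdaptiveWeights

/-! ### Bracketing decreasing functions by bins -/

section Bins

/-- The index of the bin `[i/N, (i+1)/N]` of a point of `[0,1]`, for `i < N`. The right end point
`1` belongs to the last bin. -/
noncomputable def bin (N : ℕ) (x : ℝ) : ℕ := min ⌊N * x⌋₊ (N - 1)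

lemma measurable_bin (N : ℕ) : Measurable (bin N) :=
  (Nat.measurable_floor.comp (measurable_id.const_mul (N : ℝ))).min measurable_const

lemma bin_lt {N : ℕ} (hN : 0 < N) (x : ℝ) : bin N x < N :=
  (min_le_right _ _).trans_lt (Nat.sub_lt hN one_pos)

lemma mem_Icc_bin {N : ℕ} (hN : 0 < N) {x : ℝ} (hx : x ∈ Icc (0 : ℝ) 1) :
    x ∈ Icc ((bin N x : ℝ) / N) (((bin N x + 1 : ℕ) : ℝ) / N) := by
  have hN0 : (0 : ℝ) < N := by exact_mod_cast hN
  have hNx : 0 ≤ N * x := mul_nonneg hN0.le hx.1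
  constructor
  · rw [div_le_iff₀ hN0]
    have h : ((bin N x : ℕ) : ℝ) ≤ (⌊N * x⌋₊ : ℝ) := by exact_mod_cast min_le_left _ _
    linarith [Nat.floor_le hNx]
  · rw [le_div_iff₀ hN0]
    rcases min_choice ⌊N * x⌋₊ (N - 1) with h | h
    · rw [bin, h]
      push_cast
      linarith [Nat.lt_floor_add_one (N * x)]
    · rw [bin, h, Nat.sub_add_cancel hN]
      nlinarith [hx.2]

/-- The sum of `w` over the left end points of the bins, with weights `q`. -/
noncomputable def leftSum (N : ℕ) (w : ℝ → ℝ) (q : ℕ → ℝ) : ℝ :=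
  ∑ i ∈ Finset.range N, w ((i : ℝ) / N) * q i

/-- The sum of `w` over the right end points of the bins, with weights `q`. -/
noncomputable def rightSum (N : ℕ) (w : ℝ → ℝ) (q : ℕ → ℝ) : ℝ :=
  ∑ i ∈ Finset.range N, w (((i + 1 : ℕ) : ℝ) / N) * q i

/-- The indicator of the `i`-th bin. -/
noncomputable def binIndicator (N : ℕ) (x : ℝ) (i : ℕ) : ℝ := if bin N x = i then 1 else 0

lemma measurable_binIndicator (N i : ℕ) : Measurable fun x => binIndicator N x i :=
  Measurable.ite (measurable_bin N (measurableSet_singleton i)) measurable_const measurable_const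

lemma binIndicator_mem (N : ℕ) (x : ℝ) (i : ℕ) : binIndicator N x i ∈ Icc (0 : ℝ) 1 := by
  unfold binIndicator
  split_ifs <;> simp

lemma grid_mem {N i : ℕ} (hi : i ≤ N) : (i : ℝ) / N ∈ Icc (0 : ℝ) 1 :=
  ⟨by positivity, div_le_one_of_le₀ (by exact_mod_cast hi) (by positivity)⟩

variable {N : ℕ} {w : ℝ → ℝ}

lemma rightSum_binIndicator (hN : 0 < N) (x : ℝ) :
    rightSum N w (binIndicator N x) = w (((bin N x + 1 : ℕ) : ℝ) / N) := by
  simp [rightSum, binIndicator, bin_lt hN x]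

lemma leftSum_binIndicator (hN : 0 < N) (x : ℝ) :
    leftSum N w (binIndicator N x) = w ((bin N x : ℝ) / N) := by
  simp [leftSum, binIndicator, bin_lt hN x]

lemma rightSum_le_apply (hN : 0 < N) (hw : AntitoneOn w (Icc 0 1)) {x : ℝ}
    (hx : x ∈ Icc (0 : ℝ) 1) : rightSum N w (binIndicator N x) ≤ w x := by
  rw [rightSum_binIndicator hN]
  exact hw hx (grid_mem (bin_lt hN x)) (mem_Icc_bin hN hx).2

lemma apply_le_leftSum (hN : 0 < N) (hw : AntitoneOn w (Icc 0 1)) {x : ℝ}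
    (hx : x ∈ Icc (0 : ℝ) 1) : w x ≤ leftSum N w (binIndicator N x) := by
  rw [leftSum_binIndicator hN]
  exact hw (grid_mem (bin_lt hN x).le) hx (mem_Icc_bin hN hx).1

/-- The bracket of a decreasing function has width at most its oscillation times the largest bin
weight, by telescoping. -/
lemma leftSum_le_rightSum_add (hw : AntitoneOn w (Icc 0 1)) {q : ℕ → ℝ} {η C : ℝ}
    (hη : 0 ≤ η) (hq : ∀ i, q i ≤ η) (hC : w 0 - w 1 ≤ C) (hN : 0 < N) :
    leftSum N w q ≤ rightSum N w q + C * η := by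
  have hN0 : (N : ℝ) ≠ 0 := by exact_mod_cast hN.ne'
  have h : leftSum N w q - rightSum N w q
      ≤ ∑ i ∈ Finset.range N, (w ((i : ℝ) / N) - w (((i + 1 : ℕ) : ℝ) / N)) * η := by
    rw [leftSum, rightSum, ← Finset.sum_sub_distrib]
    refine Finset.sum_le_sum fun i hi => ?_
    have hi' := Finset.mem_range.1 hi
    rw [← sub_mul]
    refine mul_le_mul_of_nonneg_left (hq i) (sub_nonneg.2 ?_)
    refine hw (grid_mem hi'.le) (grid_mem hi') ?_
    gcongr
    simp
  rw [← Finset.sum_mul, Finset.sum_range_sub' fun i : ℕ => w ((i : ℝ) / N)] at h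
  simp only [CharP.cast_eq_zero, zero_div, div_self hN0] at h
  have := mul_le_mul_of_nonneg_right hC hη
  linarith

lemma abs_leftSum_sub_le {C : ℝ} (hw : ∀ x ∈ Icc (0 : ℝ) 1, |w x| ≤ C) (q q' : ℕ → ℝ) :
    |leftSum N w q - leftSum N w q'| ≤ C * ∑ i ∈ Finset.range N, |q i - q' i| := by
  rw [leftSum, leftSum, ← Finset.sum_sub_distrib, Finset.mul_sum]
  refine (Finset.abs_sum_le_sum_abs _ _).trans (Finset.sum_le_sum fun i hi => ?_)
  rw [← mul_sub, abs_mul]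
  exact mul_le_mul_of_nonneg_right (hw _ (grid_mem (Finset.mem_range.1 hi).le)) (abs_nonneg _)

lemma abs_rightSum_sub_le {C : ℝ} (hw : ∀ x ∈ Icc (0 : ℝ) 1, |w x| ≤ C) (q q' : ℕ → ℝ) :
    |rightSum N w q - rightSum N w q'| ≤ C * ∑ i ∈ Finset.range N, |q i - q' i| := by
  rw [rightSum, rightSum, ← Finset.sum_sub_distrib, Finset.mul_sum]
  refine (Finset.abs_sum_le_sum_abs _ _).trans (Finset.sum_le_sum fun i hi => ?_)
  rw [← mul_sub, abs_mul]
  exact mul_le_mul_of_nonneg_right (hw _ (grid_mem (Finset.mem_range.1 hi))) (abs_nonneg _)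

/-- The empirical bin frequencies of `x 0, …, x (t-1)`; they are zero for `t = 0`. -/
noncomputable def binFreq (N : ℕ) (x : ℕ → ℝ) (t : ℕ) (i : ℕ) : ℝ :=
  1 / (t : ℝ) * ∑ s ∈ Finset.range t, binIndicator N (x s) i

lemma rightSum_binFreq (x : ℕ → ℝ) (t : ℕ) : rightSum N w (binFreq N x t)
    = 1 / (t : ℝ) * ∑ s ∈ Finset.range t, rightSum N w (binIndicator N (x s)) := by
  simp only [rightSum, binFreq, Finset.mul_sum]
  rw [Finset.sum_comm]
  refine Finset.sum_congr rfl fun s _ => Finset.sum_congr rfl fun i _ => by ring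

lemma leftSum_binFreq (x : ℕ → ℝ) (t : ℕ) : leftSum N w (binFreq N x t)
    = 1 / (t : ℝ) * ∑ s ∈ Finset.range t, leftSum N w (binIndicator N (x s)) := by
  simp only [leftSum, binFreq, Finset.mul_sum]
  rw [Finset.sum_comm]
  refine Finset.sum_congr rfl fun s _ => Finset.sum_congr rfl fun i _ => by ring

variable {Ω : Type*} [MeasurableSpace Ω] {Q : Measure Ω} [IsProbabilityMeasure Q]

/-- The bin probabilities of a random variable. -/
noncomputable def binProb (Q : Measure Ω) (N : ℕ) (X : Ω → ℝ) (i : ℕ) : ℝ :=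
  ∫ ω, binIndicator N (X ω) i ∂Q

lemma integrable_binIndicator {X : Ω → ℝ} (hX : Measurable X) (i : ℕ) :
    Integrable (fun ω => binIndicator N (X ω) i) Q := by
  refine Integrable.of_bound (C := 1) ((measurable_binIndicator N i).comp hX).aestronglyMeasurable
    (Eventually.of_forall fun ω => ?_)
  have h := binIndicator_mem N (X ω) i
  rw [Real.norm_eq_abs, abs_of_nonneg h.1]
  exact h.2

lemma binProb_mem {X : Ω → ℝ} (hX : Measurable X) (i : ℕ) : binProb Q N X i ∈ Icc (0 : ℝ) 1 := by
  refine ⟨integral_nonneg fun ω => (binIndicator_mem N (X ω) i).1, ?_⟩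
  have h := integral_mono (integrable_binIndicator (N := N) (Q := Q) hX i) (integrable_const 1)
    fun ω => (binIndicator_mem N (X ω) i).2
  simpa [binProb] using h

/-- Bounded decreasing functions of a `[0,1]`-valued variable are integrable: such a function is the
restriction of a decreasing function on the line. -/
lemma integrable_antitoneOn_comp {X : Ω → ℝ} (hX : Measurable X)
    (hX01 : ∀ ω, X ω ∈ Icc (0 : ℝ) 1) (hw : AntitoneOn w (Icc 0 1)) {C : ℝ}
    (hC : ∀ x ∈ Icc (0 : ℝ) 1, |w x| ≤ C) : Integrable (fun ω => w (X ω)) Q := by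
  have hanti : Antitone fun x : ℝ => w (projIcc (0 : ℝ) 1 zero_le_one x) := fun x y hxy =>
    hw (projIcc (0 : ℝ) 1 zero_le_one x).2 (projIcc (0 : ℝ) 1 zero_le_one y).2
      (monotone_projIcc _ hxy)
  have hm : Measurable fun ω => w (X ω) := by
    have heq : (fun ω => w (X ω)) = (fun x : ℝ => w (projIcc (0 : ℝ) 1 zero_le_one x)) ∘ X := by
      funext ω
      simp [projIcc_of_mem zero_le_one (hX01 ω)]
    rw [heq]
    exact hanti.measurable.comp hX
  exact Integrable.of_bound hm.aestronglyMeasurable C (Eventually.of_forall fun ω => hC _ (hX01 ω))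

lemma integral_rightSum {X : Ω → ℝ} (hX : Measurable X) :
    Integrable (fun ω => rightSum N w (binIndicator N (X ω))) Q ∧
      ∫ ω, rightSum N w (binIndicator N (X ω)) ∂Q = rightSum N w (binProb Q N X) := by
  have hi : ∀ i ∈ Finset.range N,
      Integrable (fun ω => w (((i + 1 : ℕ) : ℝ) / N) * binIndicator N (X ω) i) Q :=
    fun i _ => (integrable_binIndicator hX i).const_mul _
  refine ⟨integrable_finsetSum _ hi, ?_⟩
  simp only [rightSum]
  rw [integral_finsetSum _ hi]
  exact Finset.sum_congr rfl fun i _ => integral_const_mul _ _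

lemma integral_leftSum {X : Ω → ℝ} (hX : Measurable X) :
    Integrable (fun ω => leftSum N w (binIndicator N (X ω))) Q ∧
      ∫ ω, leftSum N w (binIndicator N (X ω)) ∂Q = leftSum N w (binProb Q N X) := by
  have hi : ∀ i ∈ Finset.range N,
      Integrable (fun ω => w ((i : ℝ) / N) * binIndicator N (X ω) i) Q :=
    fun i _ => (integrable_binIndicator hX i).const_mul _
  refine ⟨integrable_finsetSum _ hi, ?_⟩
  simp only [leftSum]
  rw [integral_finsetSum _ hi]
  exact Finset.sum_congr rfl fun i _ => integral_const_mul _ _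

lemma rightSum_le_integral (hN : 0 < N) {X : Ω → ℝ} (hX : Measurable X)
    (hX01 : ∀ ω, X ω ∈ Icc (0 : ℝ) 1) (hw : AntitoneOn w (Icc 0 1)) {C : ℝ}
    (hC : ∀ x ∈ Icc (0 : ℝ) 1, |w x| ≤ C) : rightSum N w (binProb Q N X) ≤ ∫ ω, w (X ω) ∂Q := by
  rw [← (integral_rightSum hX).2]
  exact integral_mono (integral_rightSum hX).1 (integrable_antitoneOn_comp hX hX01 hw hC)
    fun ω => rightSum_le_apply hN hw (hX01 ω)

lemma integral_le_leftSum (hN : 0 < N) {X : Ω → ℝ} (hX : Measurable X)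
    (hX01 : ∀ ω, X ω ∈ Icc (0 : ℝ) 1) (hw : AntitoneOn w (Icc 0 1)) {C : ℝ}
    (hC : ∀ x ∈ Icc (0 : ℝ) 1, |w x| ≤ C) : ∫ ω, w (X ω) ∂Q ≤ leftSum N w (binProb Q N X) := by
  rw [← (integral_leftSum hX).2]
  exact integral_mono (integrable_antitoneOn_comp hX hX01 hw hC) (integral_leftSum hX).1
    fun ω => apply_le_leftSum hN hw (hX01 ω)

lemma exists_binProb_le {Y : Ω → ℝ} (hY : Measurable Y) (hY01 : ∀ ω, Y ω ∈ Icc (0 : ℝ) 1)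
    (hac : Q.map Y ≪ uniform01) {η : ℝ} (hη : 0 < η) :
    ∃ N : ℕ, 0 < N ∧ ∀ i, binProb Q N (fun ω => 1 - Y ω) i ≤ η := by
  have : IsProbabilityMeasure (Q.map Y) := Measure.isProbabilityMeasure_map hY.aemeasurable
  obtain ⟨δ, hδ, h⟩ := exists_measure_lt_of_absolutelyContinuous hac
    (ENNReal.ofReal_pos.2 hη).ne'
  obtain ⟨n, hn⟩ := ENNReal.exists_inv_nat_lt hδ.ne'
  have hn0 : 0 < n := by
    rcases Nat.eq_zero_or_pos n with h0 | h0
    · simp [h0] at hn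
    · exact h0
  have hn0' : (0 : ℝ) < n := by exact_mod_cast hn0
  refine ⟨n, hn0, fun i => ?_⟩
  set J := Icc (1 - ((i + 1 : ℕ) : ℝ) / n) (1 - (i : ℝ) / n) with hJ
  have hJU : uniform01 J < δ := by
    refine lt_of_le_of_lt ?_ hn
    rw [uniform01]
    refine (Measure.restrict_apply_le _ _).trans ?_
    rw [hJ, Real.volume_Icc]
    have : (1 - (i : ℝ) / n - (1 - ((i + 1 : ℕ) : ℝ) / n)) = (n : ℝ)⁻¹ := by
      push_cast
      field_simp
      ring
    rw [this, ENNReal.ofReal_inv_of_pos hn0', ENNReal.ofReal_natCast]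
  have hJm : MeasurableSet (Y ⁻¹' J) := hY measurableSet_Icc
  have hlt : Q (Y ⁻¹' J) < ENNReal.ofReal η := by
    rw [← Measure.map_apply hY measurableSet_Icc]
    exact h J hJU
  have hle : binProb Q n (fun ω => 1 - Y ω) i ≤ ∫ ω, (Y ⁻¹' J).indicator 1 ω ∂Q := by
    refine integral_mono (integrable_binIndicator (measurable_const.sub hY) i)
      ((integrable_const 1).indicator hJm) fun ω => ?_
    simp only [binIndicator]
    split_ifs with hbin
    · have hmem := mem_Icc_bin hn0 (x := 1 - Y ω)
        ⟨by linarith [(hY01 ω).2], by linarith [(hY01 ω).1]⟩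
      rw [hbin] at hmem
      rw [indicator_of_mem (show ω ∈ Y ⁻¹' J from ⟨by linarith [hmem.2], by linarith [hmem.1]⟩)]
      rfl
    · exact indicator_nonneg (fun _ _ => zero_le_one) ω
  rw [integral_indicator_one hJm] at hle
  refine hle.trans ?_
  rw [measureReal_def]
  exact ENNReal.toReal_le_of_le_ofReal hη.le hlt.le

end Bins

/-! ### Sums that vanish in measure -/

section ConvergenceInMeasure

variable {Ω : Type*} [MeasurableSpace Ω] {Q : Measure Ω}

lemma tendstoInMeasure_add_zero {F G : ℕ → Ω → ℝ} (hF : TendstoInMeasure Q F atTop fun _ => 0)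
    (hG : TendstoInMeasure Q G atTop fun _ => 0) :
    TendstoInMeasure Q (fun T ω => F T ω + G T ω) atTop fun _ => 0 := by
  refine tendstoInMeasure_real_iff.2 fun ε hε => ?_
  have hsum := (tendstoInMeasure_real_iff.1 hF (ε / 2) (by positivity)).add
    (tendstoInMeasure_real_iff.1 hG (ε / 2) (by positivity))
  rw [add_zero] at hsum
  refine tendsto_of_tendsto_of_tendsto_of_le_of_le tendsto_const_nhds hsum (fun T => zero_le) ?_
  refine fun T => (measure_mono fun ω hω => ?_).trans (measure_union_le _ _)
  by_contra hcon
  simp only [mem_union, mem_ofPred_eq, not_or, not_le, sub_zero] at hcon hω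
  linarith [abs_add_le (F T ω) (G T ω)]

lemma tendstoInMeasure_sum_zero {F : ℕ → ℕ → Ω → ℝ} (N : ℕ)
    (hF : ∀ i < N, TendstoInMeasure Q (F i) atTop fun _ => 0) :
    TendstoInMeasure Q (fun T ω => ∑ i ∈ Finset.range N, F i T ω) atTop fun _ => 0 := by
  induction N with
  | zero =>
    refine tendstoInMeasure_real_iff.2 fun ε hε => ?_
    simp [not_le.2 hε]
  | succ N ih =>
    simp only [Finset.sum_range_succ]
    exact tendstoInMeasure_add_zero (ih fun i hi => hF i (by omega)) (hF N (by omega))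

end ConvergenceInMeasure

/-! ### Online Grenander calibrators -/

section Grenander

variable {a b : ℝ} {h : ℝ → ℝ}

lemma IsDecreasingDensityWithRange.antitoneOn_log (ha : 0 < a)
    (hh : IsDecreasingDensityWithRange a b h) :
    AntitoneOn (fun x => Real.log (h x)) (Icc 0 1) := fun _ hx y hy hxy =>
  Real.log_le_log (ha.trans_le (hh.mem_range y hy).1) (hh.antitone hx hy hxy)

lemma IsDecreasingDensityWithRange.log_mem (ha : 0 < a)
    (hh : IsDecreasingDensityWithRange a b h) {x : ℝ} (hx : x ∈ Icc (0 : ℝ) 1) :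
    Real.log (h x) ∈ Icc (Real.log a) (Real.log b) := by
  obtain ⟨h1, h2⟩ := hh.mem_range x hx
  exact ⟨Real.log_le_log ha h1, Real.log_le_log (ha.trans_le h1) h2⟩

lemma IsDecreasingDensityWithRange.abs_log_le (ha : 0 < a) (ha1 : a < 1) (hb : 1 < b)
    (hh : IsDecreasingDensityWithRange a b h) {x : ℝ} (hx : x ∈ Icc (0 : ℝ) 1) :
    |Real.log (h x)| ≤ Real.log b - Real.log a := by
  obtain ⟨h1, h2⟩ := hh.log_mem ha hx
  have h3 := Real.log_neg ha ha1
  have h4 := Real.log_pos hb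
  rw [abs_le]
  constructor <;> linarith

/-- An online Grenander calibrator nearly maximizes the past log-likelihood; the artificial
observations cost a bounded amount. -/
lemma IsOnlineGrenander.sum_log_le {Ω : Type*} {Y : ℕ → Ω → ℝ} {f : ℕ → Ω → ℝ → ℝ} (ha : 0 < a)
    (hf : IsOnlineGrenander Y a b f) (hh : IsDecreasingDensityWithRange a b h) (t : ℕ) (ω : Ω) :
    ∑ s ∈ Finset.range t, Real.log (h (1 - Y s ω))
      ≤ ∑ s ∈ Finset.range t, Real.log (f t ω (1 - Y s ω)) + (Real.log b - Real.log a) := by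
  have h0 : (0 : ℝ) ∈ Icc (0 : ℝ) 1 := by simp
  have h1 : (1 : ℝ) ∈ Icc (0 : ℝ) 1 := by simp
  have hh0 := hh.log_mem ha h0
  have hh1 := hh.log_mem ha h1
  have hf0 := (hf.mem t ω).log_mem ha h0
  have hf1 := (hf.mem t ω).log_mem ha h1
  rcases hf.isMaxOn t with hmax | hmax
  · have hm : ogObjective Y t ω h ≤ ogObjective Y t ω (f t ω) := hmax ω hh
    unfold ogObjective at hm
    linarith [hh1.1, hf1.2]
  · have hm : ogObjectiveHalf Y t ω h ≤ ogObjectiveHalf Y t ω (f t ω) := hmax ω hh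
    unfold ogObjectiveHalf at hm
    linarith [hh1.1, hf1.2, hh0.1, hf0.2]

variable {Ω : Type*} [MeasurableSpace Ω]

/-- The best expected log-return among the decreasing densities with range `[a,b]`, for the
p-value `X`. -/
noncomputable def optimalLogReturn (Q : Measure Ω) (a b : ℝ) (X : Ω → ℝ) : ℝ :=
  sSup ((fun h : ℝ → ℝ => ∫ ω, Real.log (h (X ω)) ∂Q) '' {h | IsDecreasingDensityWithRange a b h})

variable {Q : Measure Ω} [IsProbabilityMeasure Q]

lemma integral_log_le_optimalLogReturn (ha : 0 < a) (ha1 : a < 1) (hb : 1 < b) {X : Ω → ℝ}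
    (hX : Measurable X) (hX01 : ∀ ω, X ω ∈ Icc (0 : ℝ) 1)
    (hh : IsDecreasingDensityWithRange a b h) :
    ∫ ω, Real.log (h (X ω)) ∂Q ≤ optimalLogReturn Q a b X := by
  refine le_csSup ⟨Real.log b, ?_⟩ (mem_image_of_mem _ hh)
  rintro _ ⟨k, hk : IsDecreasingDensityWithRange a b k, rfl⟩
  have hint := integrable_antitoneOn_comp (Q := Q) hX hX01 (hk.antitoneOn_log ha)
    fun x hx => hk.abs_log_le ha ha1 hb hx
  have := integral_mono hint (integrable_const (Real.log b)) fun ω => (hk.log_mem ha (hX01 ω)).2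
  simpa using this

lemma lintegral_uniform_one_sub :
    ∫⁻ p, ENNReal.ofReal (max (1 - p) 0) ∂uniform01 = ENNReal.ofReal (1 / 2) := by
  have hint : IntegrableOn (fun p : ℝ => max (1 - p) 0) (Icc 0 1) :=
    (by fun_prop : Continuous fun p : ℝ => max (1 - p) 0).continuousOn.integrableOn_Icc
  rw [uniform01, ← ofReal_integral_eq_lintegral_ofReal hint
    (Eventually.of_forall fun p => le_max_right _ _)]
  congr 1
  rw [setIntegral_congr_fun (g := fun p : ℝ => 1 - p) measurableSet_Icc
    fun p hp => max_eq_left (by linarith [hp.2])]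
  rw [integral_Icc_eq_integral_Ioc, ← intervalIntegral.integral_of_le zero_le_one]
  rw [intervalIntegral.integral_sub (continuous_const.intervalIntegrable _ _)
    (continuous_id'.intervalIntegrable _ _)]
  norm_num

/-- A slightly tilted uniform density already has a positive expected log-return. -/
lemma optimalLogReturn_pos (ha : 0 < a) (ha1 : a < 1) (hb : 1 < b) {Y : Ω → ℝ}
    (hY : Measurable Y) (hY01 : ∀ ω, Y ω ∈ Icc (0 : ℝ) 1) (hsuper : StrictlySuperUniform Q Y)
    (hac : Q.map Y ≪ uniform01) : 0 < optimalLogReturn Q a b fun ω => 1 - Y ω := by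
  have hYint : Integrable Y Q := by
    refine Integrable.of_bound (C := 1) hY.aestronglyMeasurable (Eventually.of_forall fun ω => ?_)
    rw [Real.norm_eq_abs, abs_of_nonneg (hY01 ω).1]
    exact (hY01 ω).2
  have hmeanY : 1 / 2 < ∫ ω, Y ω ∂Q := by
    have h := lintegral_uniform_lt hY hY01 hsuper hac (g := fun p => max (1 - p) 0) (by fun_prop)
      (fun p => le_max_right _ _)
      (fun p _ q _ hpq => max_le_max (by linarith) le_rfl)
      ⟨1 / 4, by norm_num, 1 / 2, by norm_num, by norm_num⟩
      (by rw [lintegral_uniform_one_sub]; exact ENNReal.ofReal_ne_top)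
    have hmax : ∀ ω, max (1 - (1 - Y ω)) 0 = Y ω := fun ω => by
      rw [sub_sub_cancel, max_eq_left (hY01 ω).1]
    simp only [hmax] at h
    rw [lintegral_uniform_one_sub, ← ofReal_integral_eq_lintegral_ofReal hYint
      (Eventually.of_forall fun ω => (hY01 ω).1)] at h
    exact (ENNReal.ofReal_lt_ofReal_iff_of_nonneg (by norm_num)).1 h
  have hmean : 0 < ∫ ω, (Y ω - 1 / 2) ∂Q := by
    rw [integral_sub hYint (integrable_const _)]
    simpa using hmeanY
  obtain ⟨l, hl0, hl1, -, hpos⟩ := exists_integral_log_one_add_mul_pos (K := 1) (hY.sub_const _)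
    (fun ω => by
      rw [abs_le]
      constructor <;> linarith [(hY01 ω).1, (hY01 ω).2]) hmean
    (lt_min (sub_pos.2 ha1) (sub_pos.2 hb))
  have hla : l ≤ 1 - a := hl1.trans (min_le_left _ _)
  have hlb : l ≤ b - 1 := hl1.trans (min_le_right _ _)
  have hD : IsDecreasingDensityWithRange a b fun p => 1 + l * (1 / 2 - p) := by
    refine ⟨fun p _ q _ hpq => ?_, fun p hp => ⟨?_, ?_⟩, ?_⟩
    · show 1 + l * (1 / 2 - q) ≤ 1 + l * (1 / 2 - p)
      gcongr
    · nlinarith [hp.1, hp.2]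
    · nlinarith [hp.1, hp.2]
    · rw [integral_Icc_eq_integral_Ioc, ← intervalIntegral.integral_of_le zero_le_one,
        intervalIntegral.integral_add (continuous_const.intervalIntegrable _ _)
          (Continuous.intervalIntegrable (by fun_prop) _ _), intervalIntegral.integral_const_mul,
        intervalIntegral.integral_sub (continuous_const.intervalIntegrable _ _)
          (continuous_id'.intervalIntegrable _ _)]
      norm_num
  refine hpos.trans_le ?_
  refine le_trans (le_of_eq ?_) (integral_log_le_optimalLogReturn ha ha1 hb
    (measurable_const.sub hY) (fun ω => ?_) hD)
  · refine integral_congr_ae (Eventually.of_forall fun ω => ?_)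
    simp only
    ring_nf
  · exact ⟨by linarith [(hY01 ω).2], by linarith [(hY01 ω).1]⟩

/-- The expected log-return of the Grenander calibrator, read off at the bins, is close to the
optimal one, up to the deviation of the empirical bin frequencies and the width of the brackets.
At `t = 0` the frequencies and `1 / t` are zero, and the bound still holds. -/
lemma IsOnlineGrenander.optimalLogReturn_le {Y : ℕ → Ω → ℝ} (hY : ∀ t, Measurable (Y t))
    (hY01 : ∀ t ω, Y t ω ∈ Icc (0 : ℝ) 1) (ha : 0 < a) (ha1 : a < 1) (hb : 1 < b)
    {f : ℕ → Ω → ℝ → ℝ} (hf : IsOnlineGrenander Y a b f) {N : ℕ} (hN : 0 < N) {η : ℝ}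
    (hη : 0 ≤ η) (hpη : ∀ i, binProb Q N (fun ω => 1 - Y 0 ω) i ≤ η) {C : ℝ}
    (hC : C = Real.log b - Real.log a) (t : ℕ) (ω : Ω) :
    optimalLogReturn Q a b (fun ω => 1 - Y 0 ω)
      ≤ rightSum N (fun x => Real.log (f t ω x)) (binProb Q N fun ω => 1 - Y 0 ω) + 2 * C * η
        + (2 * C * ∑ i ∈ Finset.range N, |binFreq N (fun s => 1 - Y s ω) t i
            - binProb Q N (fun ω => 1 - Y 0 ω) i| + C * (1 / (t : ℝ))) := by
  have hX : Measurable fun ω => 1 - Y 0 ω := measurable_const.sub (hY 0)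
  have hX01 : ∀ s ω, 1 - Y s ω ∈ Icc (0 : ℝ) 1 := fun s ω =>
    ⟨by linarith [(hY01 s ω).2], by linarith [(hY01 s ω).1]⟩
  have h0 : (0 : ℝ) ∈ Icc (0 : ℝ) 1 := by simp
  have h1 : (1 : ℝ) ∈ Icc (0 : ℝ) 1 := by simp
  have hosc : ∀ k, IsDecreasingDensityWithRange a b k → Real.log (k 0) - Real.log (k 1) ≤ C :=
    fun k hk => by linarith [(hk.log_mem ha h0).2, (hk.log_mem ha h1).1]
  have hunif : ∃ k, IsDecreasingDensityWithRange a b k := ⟨f t ω, hf.mem t ω⟩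
  refine csSup_le (Set.Nonempty.image _ hunif) ?_
  rintro _ ⟨k, hk : IsDecreasingDensityWithRange a b k, rfl⟩
  have hft := hf.mem t ω
  have habs : ∀ k, IsDecreasingDensityWithRange a b k →
      ∀ x ∈ Icc (0 : ℝ) 1, |Real.log (k x)| ≤ C := fun k hk x hx =>
    hC ▸ hk.abs_log_le ha ha1 hb hx
  set p := binProb Q N (fun ω => 1 - Y 0 ω) with hp
  set q := binFreq N (fun s => 1 - Y s ω) t with hq
  have ht : (0 : ℝ) ≤ 1 / (t : ℝ) := by positivity
  have e1 := integral_le_leftSum (Q := Q) hN hX (hX01 0) (hk.antitoneOn_log ha) (habs k hk)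
  have e2 := leftSum_le_rightSum_add (hk.antitoneOn_log ha) hη hpη (hosc k hk) hN
  have e3 := (abs_le.1 (abs_rightSum_sub_le (N := N) (habs k hk) q p)).1
  have e4 : rightSum N (fun x => Real.log (k x)) q
      ≤ leftSum N (fun x => Real.log (f t ω x)) q + C * (1 / (t : ℝ)) := by
    rw [hq, rightSum_binFreq, leftSum_binFreq, mul_comm C, ← mul_add]
    refine mul_le_mul_of_nonneg_left ?_ ht
    calc ∑ s ∈ Finset.range t,
          rightSum N (fun x => Real.log (k x)) (binIndicator N (1 - Y s ω))
        ≤ ∑ s ∈ Finset.range t, Real.log (k (1 - Y s ω)) :=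
          Finset.sum_le_sum fun s _ => rightSum_le_apply hN (hk.antitoneOn_log ha) (hX01 s ω)
      _ ≤ ∑ s ∈ Finset.range t, Real.log (f t ω (1 - Y s ω)) + C :=
          hC ▸ hf.sum_log_le ha hk t ω
      _ ≤ _ := by
          gcongr with s
          exact apply_le_leftSum hN (hft.antitoneOn_log ha) (hX01 s ω)
  have e5 := (abs_le.1 (abs_leftSum_sub_le (N := N) (habs _ hft) q p)).2
  have e6 := leftSum_le_rightSum_add (hft.antitoneOn_log ha) hη hpη (hosc _ hft) hN
  simp only at e1 e2 e3 e4 e5 e6 ⊢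
  linarith

lemma tendsto_average_binFreq_deviation {Y : ℕ → Ω → ℝ} (hY : ∀ t, Measurable (Y t))
    (hind : iIndepFun Y Q) (hid : ∀ t, IdentDistrib (Y t) (Y 0) Q Q) (N : ℕ) (C : ℝ) :
    TendstoInMeasure Q (fun (T : ℕ) ω => 1 / (T : ℝ) * ∑ t ∈ Finset.range T,
      (2 * C * ∑ i ∈ Finset.range N, |binFreq N (fun s => 1 - Y s ω) t i
        - binProb Q N (fun ω => 1 - Y 0 ω) i| + C * (1 / (t : ℝ)))) atTop fun _ => 0 := by
  have he : ∀ i, Measurable fun y : ℝ => binIndicator N (1 - y) i := fun i =>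
    (measurable_binIndicator N i).comp (measurable_const.sub measurable_id)
  refine tendstoInMeasure_of_tendsto_ae (fun T => Measurable.aestronglyMeasurable ?_) ?_
  · refine Measurable.const_mul (Finset.measurable_sum _ fun t _ => Measurable.add_const
      (Measurable.const_mul (Finset.measurable_sum _ fun i _ => ?_) _) _) _
    refine measurable_norm.comp (Measurable.sub_const (Measurable.const_mul
      (Finset.measurable_sum _ fun s _ => (he i).comp (hY s)) _) _)
  have hslln : ∀ i, ∀ᵐ ω ∂Q, Tendsto (fun t => binFreq N (fun s => 1 - Y s ω) t i) atTop
      (𝓝 (binProb Q N (fun ω => 1 - Y 0 ω) i)) := fun i => by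
    have hX : Measurable fun ω => 1 - Y 0 ω := measurable_const.sub (hY 0)
    have hint : Integrable (fun ω => binIndicator N (1 - Y 0 ω) i) Q :=
      integrable_binIndicator hX i
    have h := strong_law_ae_real (μ := Q) (fun t ω => binIndicator N (1 - Y t ω) i) hint
      (fun s t hst => (hind.indepFun hst).comp (he i) (he i)) fun t => (hid t).comp (he i)
    filter_upwards [h] with ω hω
    refine hω.congr fun t => ?_
    rw [binFreq, one_div_mul_eq_div]
  filter_upwards [ae_all_iff.2 hslln] with ω hω
  have hdev : Tendsto (fun t : ℕ => 2 * C * ∑ i ∈ Finset.range N,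
      |binFreq N (fun s => 1 - Y s ω) t i - binProb Q N (fun ω => 1 - Y 0 ω) i|
        + C * (1 / (t : ℝ))) atTop (𝓝 0) := by
    have hs : Tendsto (fun t : ℕ => ∑ i ∈ Finset.range N,
        |binFreq N (fun s => 1 - Y s ω) t i - binProb Q N (fun ω => 1 - Y 0 ω) i|) atTop
        (𝓝 (∑ i ∈ Finset.range N, 0)) := by
      refine tendsto_finsetSum _ fun i _ => ?_
      simpa using ((hω i).sub_const (binProb Q N (fun ω => 1 - Y 0 ω) i)).abs
    have ht : Tendsto (fun t : ℕ => 1 / (t : ℝ)) atTop (𝓝 0) :=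
      tendsto_const_nhds.div_atTop tendsto_natCast_atTop_atTop
    simpa using (hs.const_mul (2 * C)).add (ht.const_mul C)
  refine hdev.cesaro.congr fun T => ?_
  rw [one_div]

/-- Log-returns that are frozen at grid points average to their conditional expectations. -/
lemma tendsto_sum_log_grid {Y : ℕ → Ω → ℝ} (hY : ∀ t, Measurable (Y t))
    (hind : iIndepFun Y Q) (hid : ∀ t, IdentDistrib (Y t) (Y 0) Q Q) (ha : 0 < a) (ha1 : a < 1)
    (hb : 1 < b) {f : ℕ → Ω → ℝ → ℝ} (hf : IsOnlineGrenander Y a b f) (N : ℕ) {x : ℕ → ℝ}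
    (hx : ∀ i < N, x i ∈ Icc (0 : ℝ) 1) :
    TendstoInMeasure Q (fun (T : ℕ) ω => ∑ i ∈ Finset.range N, 1 / (T : ℝ) *
      ∑ t ∈ Finset.range T, Real.log (f t ω (x i)) *
        (binIndicator N (1 - Y t ω) i - binProb Q N (fun ω => 1 - Y 0 ω) i)) atTop
      fun _ => 0 := by
  refine tendstoInMeasure_sum_zero N fun i hi => ?_
  have hX : Measurable fun ω => 1 - Y 0 ω := measurable_const.sub (hY 0)
  refine tendsto_measure_average_predictable hY hind hid
    (W := fun t ω => Real.log (f t ω (x i))) (C := Real.log b - Real.log a)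
    (u := fun y => binIndicator N (1 - y) i - binProb Q N (fun ω => 1 - Y 0 ω) i)
    (fun t => Real.measurable_log.comp (hf.predictable t _ (hx i hi)))
    (fun t ω => (hf.mem t ω).abs_log_le ha ha1 hb (hx i hi))
    (((measurable_binIndicator N i).comp (measurable_const.sub measurable_id)).sub_const _)
    (fun y => ?_) ?_
  · have h1 := binIndicator_mem N (1 - y) i
    have h2 := binProb_mem (Q := Q) (N := N) hX i
    rw [abs_le]
    constructor <;> linarith [h1.1, h1.2, h2.1, h2.2]
  · rw [integral_sub (integrable_binIndicator hX i) (integrable_const _)]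
    simp [binProb]

/-- The online Grenander process grows at the optimal rate among the decreasing densities with
range `[a,b]`. -/
lemma IsOnlineGrenander.hasExponentialGrowth {Y : ℕ → Ω → ℝ} (hY : ∀ t, Measurable (Y t))
    (hY01 : ∀ t ω, Y t ω ∈ Icc (0 : ℝ) 1) (hind : iIndepFun Y Q)
    (hid : ∀ t, IdentDistrib (Y t) (Y 0) Q Q) (hsuper : StrictlySuperUniform Q (Y 0))
    (hac : Q.map (Y 0) ≪ uniform01) (ha : 0 < a) (ha1 : a < 1) (hb : 1 < b)
    {f : ℕ → Ω → ℝ → ℝ} (hf : IsOnlineGrenander Y a b f) :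
    HasExponentialGrowth Q (productProcess Y f) := by
  set V := optimalLogReturn Q a b (fun ω => 1 - Y 0 ω) with hV
  refine ⟨V, optimalLogReturn_pos ha ha1 hb (hY 0) (hY01 0) hsuper hac,
    tendstoInMeasure_real_iff.2 fun ε hε => ?_⟩
  have hX : Measurable fun ω => 1 - Y 0 ω := measurable_const.sub (hY 0)
  have hX01 : ∀ s ω, 1 - Y s ω ∈ Icc (0 : ℝ) 1 := fun s ω =>
    ⟨by linarith [(hY01 s ω).2], by linarith [(hY01 s ω).1]⟩
  set C := Real.log b - Real.log a with hC
  have hC0 : 0 < C := by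
    have h3 := Real.log_neg ha ha1
    have h4 := Real.log_pos hb
    linarith
  obtain ⟨N, hN, hpη⟩ := exists_binProb_le (hY 0) (hY01 0) hac
    (show 0 < ε / (4 * C) by positivity)
  set η := ε / (4 * C) with hη
  have hη0 : 0 ≤ η := by positivity
  have hCη : 2 * C * η = ε / 2 := by
    rw [hη]
    field_simp
    ring
  set p := binProb Q N (fun ω => 1 - Y 0 ω) with hp
  have hA := tendsto_average_binFreq_deviation (Q := Q) hY hind hid N C
  have hR := tendsto_sum_log_grid (Q := Q) hY hind hid ha ha1 hb hf N
    (x := fun i => ((i + 1 : ℕ) : ℝ) / N) fun i hi => grid_mem hi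
  have hL := tendsto_sum_log_grid (Q := Q) hY hind hid ha ha1 hb hf N
    (x := fun i => (i : ℝ) / N) fun i hi => grid_mem hi.le
  have hsum := ((tendstoInMeasure_real_iff.1 hA (ε / 8) (by positivity)).add
    (tendstoInMeasure_real_iff.1 hR (ε / 8) (by positivity))).add
    (tendstoInMeasure_real_iff.1 hL (ε / 8) (by positivity))
  simp only [add_zero] at hsum
  refine tendsto_of_tendsto_of_tendsto_of_le_of_le' tendsto_const_nhds hsum
    (Eventually.of_forall fun T => zero_le) ?_
  filter_upwards [eventually_ge_atTop 1] with T hT1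
  have hT0 : (0 : ℝ) < T := by exact_mod_cast hT1
  refine (measure_mono fun ω hω => ?_).trans
    ((measure_union_le _ _).trans (add_le_add (measure_union_le _ _) le_rfl))
  by_contra hcon
  simp only [mem_union, mem_ofPred_eq, not_or, not_le, sub_zero] at hcon hω
  obtain ⟨⟨hA', hR'⟩, hL'⟩ := hcon
  rw [abs_lt] at hA' hR' hL'
  have hlogprod : Real.log (productProcess Y f T ω)
      = ∑ t ∈ Finset.range T, Real.log (f t ω (1 - Y t ω)) :=
    Real.log_prod fun t _ => (ha.trans_le ((hf.mem t ω).mem_range _ (hX01 t ω)).1).ne'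
  have hmean : ∀ c : ℝ, 1 / (T : ℝ) * ∑ t ∈ Finset.range T, c = c := fun c => by
    rw [Finset.sum_const, Finset.card_range, nsmul_eq_mul, one_div, inv_mul_cancel_left₀ hT0.ne']
  have hscale : ∀ {F G : ℕ → ℝ}, (∀ t, F t ≤ G t) →
      1 / (T : ℝ) * ∑ t ∈ Finset.range T, F t ≤ 1 / (T : ℝ) * ∑ t ∈ Finset.range T, G t :=
    fun hFG => mul_le_mul_of_nonneg_left (Finset.sum_le_sum fun t _ => hFG t) (by positivity)
  set w := fun t x => Real.log (f t ω x) with hw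
  have hR2 : ∑ i ∈ Finset.range N, 1 / (T : ℝ) * ∑ t ∈ Finset.range T,
      w t (((i + 1 : ℕ) : ℝ) / N) * (binIndicator N (1 - Y t ω) i - p i)
      = 1 / (T : ℝ) * ∑ t ∈ Finset.range T, rightSum N (w t) (binIndicator N (1 - Y t ω))
        - 1 / (T : ℝ) * ∑ t ∈ Finset.range T, rightSum N (w t) p := by
    rw [← Finset.mul_sum, Finset.sum_comm, ← mul_sub, ← Finset.sum_sub_distrib]
    simp only [rightSum, ← Finset.sum_sub_distrib, mul_sub]
  have hL2 : ∑ i ∈ Finset.range N, 1 / (T : ℝ) * ∑ t ∈ Finset.range T,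
      w t ((i : ℝ) / N) * (binIndicator N (1 - Y t ω) i - p i)
      = 1 / (T : ℝ) * ∑ t ∈ Finset.range T, leftSum N (w t) (binIndicator N (1 - Y t ω))
        - 1 / (T : ℝ) * ∑ t ∈ Finset.range T, leftSum N (w t) p := by
    rw [← Finset.mul_sum, Finset.sum_comm, ← mul_sub, ← Finset.sum_sub_distrib]
    simp only [leftSum, ← Finset.sum_sub_distrib, mul_sub]
  have hanti : ∀ t, AntitoneOn (w t) (Icc 0 1) := fun t => (hf.mem t ω).antitoneOn_log ha
  have s1 := hscale fun t => rightSum_le_apply hN (hanti t) (hX01 t ω)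
  have s2 := hscale fun t => apply_le_leftSum hN (hanti t) (hX01 t ω)
  have s3 := hscale fun t => hf.optimalLogReturn_le (Q := Q) hY hY01 ha ha1 hb hN hη0 hpη hC t ω
  rw [Finset.sum_add_distrib, Finset.sum_add_distrib, mul_add, mul_add, hmean, hmean] at s3
  have s4 := hscale fun t => (rightSum_le_integral (Q := Q) hN hX (hX01 0) (hanti t)
    (fun x hx => (hf.mem t ω).abs_log_le ha ha1 hb hx)).trans
    (integral_log_le_optimalLogReturn ha ha1 hb hX (hX01 0) (hf.mem t ω))
  rw [hmean] at s4
  have s5 := hscale fun t => leftSum_le_rightSum_add (hanti t) hη0 hpη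
    (show w t 0 - w t 1 ≤ C by
      have h0 := (hf.mem t ω).log_mem ha (show (0 : ℝ) ∈ Icc (0 : ℝ) 1 by simp)
      have h1 := (hf.mem t ω).log_mem ha (show (1 : ℝ) ∈ Icc (0 : ℝ) 1 by simp)
      simp only [hw]
      linarith [h0.2, h1.1]) hN
  rw [Finset.sum_add_distrib, mul_add, hmean] at s5
  simp only [← hV, ← hp] at s3 s4 s5 hA' hR' hL'
  rw [hR2] at hR'
  rw [hL2] at hL'
  rw [hlogprod] at hω
  refine absurd hω (not_le.2 ?_)
  rw [abs_lt]
  constructor <;> linarith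

end Grenander

/-! ### Calibrators as functions on the line -/

section Calibrators

/-- The restriction of a calibrator to `[0,1]`, extended by zero: it agrees with the calibrator at
all p-values, and it is measurable on the line. -/
noncomputable def zeroExtension (g : ℝ → ℝ) (p : ℝ) : ℝ :=
  if p = 0 then g 0 else (Ioc (0 : ℝ) 1).indicator g p

variable {g : ℝ → ℝ}

lemma zeroExtension_apply {p : ℝ} (hp : p ∈ Icc (0 : ℝ) 1) : zeroExtension g p = g p := by
  unfold zeroExtension
  split_ifs with h
  · rw [h]
  · have hmem : p ∈ Ioc (0 : ℝ) 1 := ⟨lt_of_le_of_ne hp.1 (Ne.symm h), hp.2⟩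
    exact indicator_of_mem hmem g

lemma nonconstant_zeroExtension (hg : Nonconstant g) : Nonconstant (zeroExtension g) := by
  obtain ⟨x, hx, y, hy, hxy⟩ := hg
  refine ⟨x, hx, y, hy, ?_⟩
  rwa [zeroExtension_apply ⟨hx.1.le, hx.2.le⟩, zeroExtension_apply ⟨hy.1.le, hy.2.le⟩]

namespace IsCalibrator

lemma zeroExtension_nonneg (hg : IsCalibrator g) (p : ℝ) : 0 ≤ zeroExtension g p := by
  unfold zeroExtension
  split_ifs with h
  · exact hg.nonneg 0 (by simp)
  · exact indicator_nonneg (fun p hp => hg.nonneg p ⟨hp.1.le, hp.2⟩) p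

lemma measurable_zeroExtension (hg : IsCalibrator g) : Measurable (zeroExtension g) := by
  refine Measurable.ite (measurableSet_singleton 0) measurable_const ?_
  refine measurable_of_restrict_of_restrict_compl (measurableSet_Ioc (a := (0 : ℝ)) (b := 1)) ?_ ?_
  · have heq : (Ioc (0 : ℝ) 1).domRestrict ((Ioc (0 : ℝ) 1).indicator g)
        = (Ioc (0 : ℝ) 1).domRestrict g := funext fun x => indicator_of_mem x.2 g
    have hanti : Antitone ((Ioc (0 : ℝ) 1).domRestrict g) := fun x y hxy => hg.antitone x.2 y.2 hxy
    rw [heq]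
    exact hanti.measurable
  · have heq : (Ioc (0 : ℝ) 1)ᶜ.domRestrict ((Ioc (0 : ℝ) 1).indicator g) = fun _ => 0 :=
      funext fun x => indicator_of_notMem x.2 g
    rw [heq]
    exact measurable_const

lemma antitoneOn_zeroExtension (hg : IsCalibrator g) : AntitoneOn (zeroExtension g) (Ioc 0 1) :=
  fun x hx y hy hxy => by
    rw [zeroExtension_apply ⟨hx.1.le, hx.2⟩, zeroExtension_apply ⟨hy.1.le, hy.2⟩]
    exact hg.antitone hx hy hxy

lemma lintegral_zeroExtension (hg : IsCalibrator g) :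
    ∫⁻ p, ENNReal.ofReal (zeroExtension g p) ∂uniform01 = 1 := by
  have h1 : ∫ p in Icc (0 : ℝ) 1, zeroExtension g p = 1 :=
    (setIntegral_congr_fun measurableSet_Icc fun p hp => zeroExtension_apply hp).trans
      hg.integral_eq_one
  -- A nonzero Bochner integral certifies integrability.
  have hint : Integrable (zeroExtension g) (volume.restrict (Icc (0 : ℝ) 1)) :=
    not_imp_comm.1 integral_undef (by rw [h1]; exact one_ne_zero)
  rw [uniform01, ← ofReal_integral_eq_lintegral_ofReal hint
    (Eventually.of_forall hg.zeroExtension_nonneg), h1, ENNReal.ofReal_one]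

end IsCalibrator

end Calibrators

/-! ### The weight-adaptive process -/

section WeightAdaptive

variable {Ω : Type*} {Y : ℕ → Ω → ℝ} {g : ℝ → ℝ} {γ : ℝ} {lam : ℕ → Ω → ℝ}

lemma IsAdaptiveWeight.mem_Icc (hlam : IsAdaptiveWeight Y g γ lam) (hγ : 0 ≤ γ) (t : ℕ) (ω : Ω) :
    lam t ω ∈ Icc 0 γ := by
  rcases Nat.eq_zero_or_pos t with h | h
  · rw [h, hlam.zero]
    exact ⟨le_rfl, hγ⟩
  · exact hlam.mem t h ω

lemma weightedCalibrator_pos (hlam : IsAdaptiveWeight Y g γ lam) (hg : IsCalibrator g)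
    (hγ : γ ∈ Ioo (0 : ℝ) 1) (t : ℕ) (ω : Ω) {p : ℝ} (hp : p ∈ Icc (0 : ℝ) 1) :
    0 < weightedCalibrator g lam t ω p :=
  (sub_pos.2 hγ.2).trans_le (one_sub_le_mix (hlam.mem_Icc hγ.1.le t ω) (hg.nonneg p hp))

/-- The weight-adaptive process grows at the rate of the best constant weight. -/
lemma IsAdaptiveWeight.hasExponentialGrowth [MeasurableSpace Ω] {Q : Measure Ω}
    [IsProbabilityMeasure Q] (hY : ∀ t, Measurable (Y t)) (hY01 : ∀ t ω, Y t ω ∈ Icc (0 : ℝ) 1)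
    (hind : iIndepFun Y Q) (hid : ∀ t, IdentDistrib (Y t) (Y 0) Q Q)
    (hsuper : StrictlySuperUniform Q (Y 0))
    (hkl : InformationTheory.klDiv (Q.map (Y 0)) uniform01 < ⊤) (hg : IsCalibrator g)
    (hgnc : Nonconstant g) (hγ : γ ∈ Ioo (0 : ℝ) 1) (hlam : IsAdaptiveWeight Y g γ lam) :
    HasExponentialGrowth Q (weightAdaptiveProcess Y g lam) := by
  have hac := (InformationTheory.klDiv_ne_top_iff.1 hkl.ne).1
  have hX01 : ∀ s ω, 1 - Y s ω ∈ Icc (0 : ℝ) 1 := fun s ω =>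
    ⟨by linarith [(hY01 s ω).2], by linarith [(hY01 s ω).1]⟩
  set G := zeroExtension g with hG
  have hGm : Measurable G := hg.measurable_zeroExtension
  have hGg : ∀ s ω, g (1 - Y s ω) = G (1 - Y s ω) := fun s ω =>
    (zeroExtension_apply (hX01 s ω)).symm
  have hk : Measurable fun y : ℝ => G (1 - y) := hGm.comp (measurable_const.sub measurable_id)
  have hZ : ∀ t, Measurable fun ω => G (1 - Y t ω) := fun t => hk.comp (hY t)
  have hmean : 1 < ∫⁻ ω, ENNReal.ofReal (G (1 - Y 0 ω)) ∂Q := by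
    have h := lintegral_uniform_lt (hY 0) (hY01 0) hsuper hac hGm hg.zeroExtension_nonneg
      hg.antitoneOn_zeroExtension (nonconstant_zeroExtension hgnc)
      (by rw [hg.lintegral_zeroExtension]; exact ENNReal.one_ne_top)
    rwa [hg.lintegral_zeroExtension] at h
  obtain ⟨K, hK0, hK⟩ := exists_one_lt_integral_min (hZ 0)
    (fun ω => hg.zeroExtension_nonneg _) hmean
  have hlog : Integrable (fun ω => Real.log (1 + G (1 - Y 0 ω))) Q := by
    have : IsProbabilityMeasure (Q.map (Y 0)) :=
      Measure.isProbabilityMeasure_map (hY 0).aemeasurable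
    have hfin : ∫⁻ y, ENNReal.ofReal (G (1 - y)) ∂uniform01 ≠ ⊤ := by
      rw [lintegral_uniform_comp_one_sub fun p => ENNReal.ofReal (G p), hg.lintegral_zeroExtension]
      exact ENNReal.one_ne_top
    exact (integrable_log_one_add_of_klDiv hkl hk (fun y => hg.zeroExtension_nonneg _)
      hfin).comp_measurable (hY 0)
  obtain ⟨c, hc, hlim⟩ := exists_tendsto_log_wealth (Z := fun t ω => G (1 - Y t ω)) hZ
    (fun t ω => hg.zeroExtension_nonneg _) (fun s t hst => (hind.indepFun hst).comp hk hk)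
    (fun t => (hid t).comp hk) hlog hK0 hK hγ hlam.mem (fun t ht ω => by
      simpa only [hGg] using hlam.isMaxOn t ht ω)
  have hlogM : ∀ (T : ℕ) ω, Real.log (weightAdaptiveProcess Y g lam T ω)
      = ∑ t ∈ Finset.range T, Real.log ((1 - lam t ω) + lam t ω * G (1 - Y t ω)) := by
    intro T ω
    rw [weightAdaptiveProcess, productProcess,
      Real.log_prod fun t _ => (weightedCalibrator_pos hlam hg hγ t ω (hX01 t ω)).ne']
    simp only [weightedCalibrator, hGg]
  refine ⟨c, hc, tendstoInMeasure_of_tendsto_ae (fun T => Measurable.aestronglyMeasurable ?_) ?_⟩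
  · simp only [hlogM]
    have hlm : ∀ t, Measurable (lam t) := fun t => (hlam.measurable t).mono (past_le hY t) le_rfl
    exact (Finset.measurable_sum _ fun t _ => Real.measurable_log.comp
      ((measurable_const.sub (hlm t)).add ((hlm t).mul (hZ t)))).const_mul _
  · simpa only [hlogM] using hlim

end WeightAdaptive

end Watermark

theorem theorem5p2 {Ω : Type*} [MeasurableSpace Ω] (Q : Measure Ω) [IsProbabilityMeasure Q]
    -- the pivotal statistics under the alternative
    (Y : ℕ → Ω → ℝ) (hYmeas : ∀ t, Measurable (Y t)) (hY01 : ∀ t ω, Y t ω ∈ Icc (0 : ℝ) 1)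
    (hYindep : iIndepFun Y Q) (hYident : ∀ t, IdentDistrib (Y t) (Y 0) Q Q)
    (hYsuper : Watermark.StrictlySuperUniform Q (Y 0))
    (hYkl : InformationTheory.klDiv (Q.map (Y 0)) Watermark.uniform01 < ⊤)
    -- the weight-adaptive e-process
    (g : ℝ → ℝ) (hg : Watermark.IsCalibrator g) (hgnc : Watermark.Nonconstant g)
    (γ : ℝ) (hγ : γ ∈ Ioo (0 : ℝ) 1)
    (lam : ℕ → Ω → ℝ) (hlam : Watermark.IsAdaptiveWeight Y g γ lam)
    -- the online Grenander e-process with range `[a,b]`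
    (a b : ℝ) (ha : 0 < a) (ha1 : a < 1) (hb : 1 < b)
    (f : ℕ → Ω → ℝ → ℝ) (hf : Watermark.IsOnlineGrenander Y a b f) :
    (Watermark.HasExponentialGrowth Q (Watermark.weightAdaptiveProcess Y g lam) ∧
      ∀ α ∈ Ioo (0 : ℝ) 1,
        Watermark.IsConsistent Q (Watermark.weightAdaptiveProcess Y g lam) α) ∧
    (Watermark.HasExponentialGrowth Q (Watermark.productProcess Y f) ∧
      ∀ α ∈ Ioo (0 : ℝ) 1, Watermark.IsConsistent Q (Watermark.productProcess Y f) α) ∧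
    (Watermark.HasExponentialGrowth Q
        (Watermark.averageProcess (Watermark.weightAdaptiveProcess Y g lam)
          (Watermark.productProcess Y f)) ∧
      ∀ α ∈ Ioo (0 : ℝ) 1, Watermark.IsConsistent Q
        (Watermark.averageProcess (Watermark.weightAdaptiveProcess Y g lam)
          (Watermark.productProcess Y f)) α) ∧
    -- the average with arbitrary predictable calibrators, for instance unrestricted Grenander ones
    (∀ h : ℕ → Ω → ℝ → ℝ, (∀ t, Watermark.IsPredictableCalibrator Y t (h t)) →
      Watermark.GrowsExponentiallyAtLeast Q
        (Watermark.averageProcess (Watermark.weightAdaptiveProcess Y g lam)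
          (Watermark.productProcess Y h)) ∧
      ∀ α ∈ Ioo (0 : ℝ) 1, Watermark.IsConsistent Q
        (Watermark.averageProcess (Watermark.weightAdaptiveProcess Y g lam)
          (Watermark.productProcess Y h)) α) := by
  have hac := (InformationTheory.klDiv_ne_top_iff.1 hYkl.ne).1
  have hX01 : ∀ s ω, 1 - Y s ω ∈ Icc (0 : ℝ) 1 := fun s ω =>
    ⟨by linarith [(hY01 s ω).2], by linarith [(hY01 s ω).1]⟩
  have hWA := hlam.hasExponentialGrowth hYmeas hY01 hYindep hYident hYsuper hYkl hg hgnc hγ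
  have hOG := hf.hasExponentialGrowth hYmeas hY01 hYindep hYident hYsuper hac ha ha1 hb
  have hWA0 : ∀ t ω, 0 < Watermark.weightAdaptiveProcess Y g lam t ω := fun t ω => by
    rw [Watermark.weightAdaptiveProcess, Watermark.productProcess]
    exact Finset.prod_pos fun s _ => Watermark.weightedCalibrator_pos hlam hg hγ s ω (hX01 s ω)
  have hOG0 : ∀ t ω, 0 < Watermark.productProcess Y f t ω := fun t ω =>
    Finset.prod_pos fun s _ => ha.trans_le ((hf.mem s ω).mem_range _ (hX01 s ω)).1
  have hAV := hWA.average hWA0 hOG0 hOG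
  refine ⟨⟨hWA, fun α hα => ?_⟩, ⟨hOG, fun α hα => ?_⟩, ⟨hAV, fun α hα => ?_⟩, fun h hh => ?_⟩
  · exact hWA.growsExponentiallyAtLeast.isConsistent (fun t ω => (hWA0 t ω).le) hα.1
  · exact hOG.growsExponentiallyAtLeast.isConsistent (fun t ω => (hOG0 t ω).le) hα.1
  · exact hAV.growsExponentiallyAtLeast.isConsistent (Watermark.averageProcess_nonneg
      (fun t ω => (hWA0 t ω).le) fun t ω => (hOG0 t ω).le) hα.1
  · have hh0 : ∀ t ω, 0 ≤ Watermark.productProcess Y h t ω := fun t ω =>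
      Finset.prod_nonneg fun s _ => ((hh s).2 ω).nonneg _ (hX01 s ω)
    have hgrow := hWA.growsExponentiallyAtLeast.average hWA0 hh0
    exact ⟨hgrow, fun α hα => hgrow.isConsistent
      (Watermark.averageProcess_nonneg (fun t ω => (hWA0 t ω).le) hh0) hα.1⟩
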